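/- For a finite-dimensional complex Lie algebra $\mathfrak g$ and $f\in\mathfrak g^*$, put $\mathfrak g_f=\{x\in\mathfrak g : f([x,y])=0 \text{ for all } y\in\mathfrak g\}$, and define the index of $\mathfrak g$ by $\chi[\mathfrak g]=\min\{\dim\mathfrak g_f : f\in\mathfrak g^*\}$. For $(a_1,\dots,a_k)\in\mathbb N^k$ with sum $n$, let $\mathfrak p(a_1,\dots,a_k)\subseteq\mathfrak{gl}(n,\mathbb C)$ be the standard parabolic subalgebra of block upper triangular matrices with successive diagonal blocks of sizes $a_1,\dots,a_k$. Let $\gcd(r,s)$ denote the greatest common divisor of $r$ and $s$, with $\gcd(r,0)=r$. **Theorem.** Let $a,b\geq 1$ be integers. Then $$\chi[\mathfrak p(a,a,a,b)]=\chi[\mathfrak p(\gcd(a,b),a,a)]=\gcd\bigl(a+\gcd(a,b),\,a-\gcd(a,b)\bigr).$$ Moreover: 1. $\chi[\mathfrak p(a,a,a,b)]=2\gcd(a,b)$ if $a$ is odd, and $\chi[\mathfrak p(a,a,a,b)]=\gcd(a,b)$ if $a$ is even and $b$ is odd. 2. $\chi[\mathfrak p(a,a,a,b)]=1$ if and only if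 $a$ is even and $\gcd(a,b)=1$. -/

import Mathlib

attribute [local instance] LieRing.ofAssociativeRing

/-- The stabilizer `{x ∈ L | f ⁅x, y⁆ = 0 for all y ∈ L}` of a linear form `f` on a Lie algebra `L`
under the coadjoint action. -/
def coadjointStabilizer {K L : Type*} [Field K] [LieRing L] [LieAlgebra K L]
    (f : Module.Dual K L) : LieSubalgebra K L where
  carrier := {x | ∀ y, f ⁅x, y⁆ = 0}
  zero_mem' y := by simp
  add_mem' {x x'} hx hx' y := by simp [hx y, hx' y]
  smul_mem' c x hx y := by simp [hx y]
  lie_mem' {x x'} hx hx' y := by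
    have h1 : f ⁅x, ⁅x', y⁆⁆ = 0 := hx _
    have h2 : f ⁅x', ⁅x, y⁆⁆ = 0 := hx' _
    simp [lie_lie, h1, h2]

/-- The index of a (finite-dimensional) Lie algebra: the minimum, over all linear forms `f`,
of the dimension of the stabilizer of `f`. The set of dimensions is a nonempty set of natural
numbers, so its infimum is attained. -/
noncomputable def lieIndex (K L : Type*) [Field K] [LieRing L] [LieAlgebra K L] : ℕ :=
  sInf (Set.range fun f : Module.Dual K L => Module.finrank K (coadjointStabilizer f))

/-- The standard parabolic subalgebra `𝔭(a₁, …, aₖ)` of `𝔤𝔩(n, ℂ)`, `n = a₁ + ⋯ + aₖ`: the matrices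
that are block upper triangular with diagonal blocks of sizes `a₁, …, aₖ`, i.e. those that stabilize
each coordinate subspace spanned by the first `s = a₁ + ⋯ + aᵢ` basis vectors. Zero entries
of the list impose no new condition. -/
def parabolic (l : List ℕ) : LieSubalgebra ℂ (Matrix (Fin l.sum) (Fin l.sum) ℂ) where
  carrier := {M | ∀ (k : ℕ) (i j : Fin l.sum),
    (j : ℕ) < (l.take k).sum → (l.take k).sum ≤ (i : ℕ) → M i j = 0}
  zero_mem' k i j _ _ := rfl
  add_mem' {M N} hM hN k i j hj hi := by
    rw [Matrix.add_apply, hM k i j hj hi, hN k i j hj hi, add_zero]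
  smul_mem' c M hM k i j hj hi := by
    rw [Matrix.smul_apply, hM k i j hj hi, smul_zero]
  lie_mem' {M N} hM hN k i j hj hi := by
    have key : ∀ A B : Matrix (Fin l.sum) (Fin l.sum) ℂ,
        (∀ (k : ℕ) (i j : Fin l.sum),
          (j : ℕ) < (l.take k).sum → (l.take k).sum ≤ (i : ℕ) → A i j = 0) →
        (∀ (k : ℕ) (i j : Fin l.sum),
          (j : ℕ) < (l.take k).sum → (l.take k).sum ≤ (i : ℕ) → B i j = 0) →
        (A * B) i j = 0 := by
      intro A B hA hB
      rw [Matrix.mul_apply]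
      refine Finset.sum_eq_zero fun m _ => ?_
      rcases lt_or_ge (m : ℕ) (l.take k).sum with h | h
      · rw [hA k i m h hi, zero_mul]
      · rw [hB k m j hj h, mul_zero]
    rw [Ring.lie_def, Matrix.sub_apply, key M N hM hN, key N M hN hM, sub_zero]

/-- The index `χ[𝔭(a₁, …, aₖ)]`. -/
noncomputable def parabolicIndex (l : List ℕ) : ℕ := lieIndex ℂ (parabolic l)

/-! Write linear forms on a parabolic as `M ↦ tr (F * M)`. For every pair of compositions of `n`, a
form on the associated seaweed algebra is built whose stabilizer consists of diagonal matrices,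
those constant along the nonzero entries of `F`. Its dimension is the number of orbits of the
composite of the two block reversals. The construction (`hasRigidForm`) is a Euclid-style reduction
on the two leading blocks, carried by three block-matrix constructions.

Such a form attains the minimum (`IsRigid.finrank_edgeInvariants_le`). Its parabolic conjugates,
perturbed within the classes of positions joined by `F`, fill a neighbourhood of it modulo matrices
pairing to zero with the parabolic, and all of these forms keep a conjugate of the same diagonal
torus in their stabilizer. Upper semicontinuity along lines carries the bound to every form. So the
index is an orbit count (`parabolicIndex_eq_card`).

For three blocks, adjoining a second copy of the middle block turns the permutation into a rotation,
which gives a gcd. For `(a,a,a,b)`, the first return to the first `3a` positions is, modulo `3a`,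
the map `x ↦ x + b + (2 + ⌊x/a⌋)a`. Modulo `a` it is rotation by `b`, with `d = gcd(a,b)` orbits of
length `m = a/d`; over each residue lie three points, and a shift by `ae` is sent to a shift by
`2ae`. Hence the `m`-th iterate acts on a fibre, a copy of `ℤ/3`, as an affine map of slope `2^m`.
For `m` odd this is a reflection, with two orbits, so the index is `2d`. For `m` even it is a
translation, and an alternating sum of floors shows that it is nontrivial, so the index is `d`. The
same dichotomy comes from `gcd(a+d, a-d) = d * gcd(2, m-1)`. -/

open Matrix

/-! ### Rigid forms, with relabelling and transposition. -/

/-- The stabilizer of the form `M ↦ tr (F * M)` in the algebra of matrices supported on `r`. -/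
def incidenceStabilizer {ι : Type*} [Fintype ι] (r : ι → ι → Prop) (F : Matrix ι ι ℂ) :
    Submodule ℂ (Matrix ι ι ℂ) where
  carrier := {M | (∀ i j, ¬ r i j → M i j = 0) ∧ ∀ i j, r j i → (F * M) i j = (M * F) i j}
  zero_mem' := by simp
  add_mem' {M N} hM hN := by
    refine ⟨fun i j h => by simp [hM.1 i j h, hN.1 i j h], fun i j h => ?_⟩
    rw [mul_add, add_mul, Matrix.add_apply, Matrix.add_apply, hM.2 i j h, hN.2 i j h]
  smul_mem' c M hM := by
    refine ⟨fun i j h => by simp [hM.1 i j h], fun i j h => ?_⟩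
    rw [mul_smul_comm, smul_mul_assoc, Matrix.smul_apply, Matrix.smul_apply, hM.2 i j h]

/-- `F` is supported on the opposite of `r` and all elements of its stabilizer are diagonal. -/
def IsRigid {ι : Type*} [Fintype ι] (r : ι → ι → Prop) (F : Matrix ι ι ℂ) : Prop :=
  (∀ i j, ¬ r j i → F i j = 0) ∧ ∀ M ∈ incidenceStabilizer r F, ∀ i j, i ≠ j → M i j = 0

theorem IsRigid.congr {ι : Type*} [Fintype ι] {r r' : ι → ι → Prop} {F : Matrix ι ι ℂ}
    (h : IsRigid r F) (hr : ∀ i j, r' i j ↔ r i j) : IsRigid r' F := by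
  have : r' = r := by ext i j; exact hr i j
  rwa [this]

theorem IsRigid.reindex {ι κ : Type*} [Fintype ι] [Fintype κ] {r : ι → ι → Prop}
    {F : Matrix ι ι ℂ} (h : IsRigid r F) (e : κ ≃ ι) :
    IsRigid (fun i j => r (e i) (e j)) (F.submatrix e e) := by
  refine ⟨fun i j hij => h.1 _ _ hij, fun M hM i j hij => ?_⟩
  have := h.2 (M.submatrix e.symm e.symm) ⟨fun i j hij => hM.1 _ _ (by simpa using hij), ?_⟩
    (e i) (e j) (by simpa using hij)
  · simpa using this
  · intro i j hij
    have h2 := hM.2 (e.symm i) (e.symm j) (by simpa using hij)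
    have hF : F = (F.submatrix e e).submatrix e.symm e.symm := by simp
    rw [hF, submatrix_mul_equiv, submatrix_mul_equiv]
    exact h2

theorem IsRigid.transpose {ι : Type*} [Fintype ι] {r : ι → ι → Prop}
    {F : Matrix ι ι ℂ} (h : IsRigid r F) : IsRigid (fun i j => r j i) Fᵀ := by
  refine ⟨fun i j hij => h.1 _ _ hij, fun M hM i j hij => ?_⟩
  refine h.2 Mᵀ ⟨fun i j hij => hM.1 _ _ hij, fun i j hij => ?_⟩ j i hij.symm
  have h2 := hM.2 j i hij
  have h3 : F * Mᵀ = (M * Fᵀ)ᵀ := by simp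
  have h4 : Mᵀ * F = (Fᵀ * M)ᵀ := by simp
  rw [h3, h4, transpose_apply, transpose_apply, h2]

/-! ### Block constructions that enlarge a rigid form. -/

section Steps

set_option linter.unusedSectionVars false

variable {A C N : Type*} [Fintype A] [Fintype C] [Fintype N]
  [DecidableEq A] [DecidableEq C] [DecidableEq N]

/-- The matrix of the linear map sending the basis vector `e x` to `e (g x)`. -/
def mapMatrix (g : A → N) : Matrix N A ℂ := fun y x => if y = g x then 1 else 0

theorem mul_mapMatrix {l : Type*} (g : A → N) (M : Matrix l N ℂ) (i : l) (x : A) :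
    (M * mapMatrix g) i x = M i (g x) := by
  simp [mul_apply, mapMatrix]

theorem mapMatrix_mul_apply {l : Type*} {g : A → N} (hg : g.Injective) (M : Matrix A l ℂ)
    (x : A) (j : l) : (mapMatrix g * M) (g x) j = M x j := by
  simp [mul_apply, mapMatrix, hg.eq_iff]

theorem mapMatrix_mul_apply_of_notMem {l : Type*} {g : A → N} (M : Matrix A l ℂ)
    {y : N} (hy : ∀ x, y ≠ g x) (j : l) : (mapMatrix g * M) y j = 0 := by
  simp [mul_apply, mapMatrix, hy]

/-- Write `M` as `X, Y, 0, Z`. The block `mapMatrix g` forces `X` to be the restriction of `Z` along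
`g`, kills the columns of `Y` in the image of `g`, and kills the entries of `Z` from the rest of `P`
into that image. The last vanishing is what refines `r` to `r'`, so `Z` stabilizes `R` and is
diagonal; the remaining columns of `Y` then vanish as well. -/
theorem isRigid_fromBlocks_injective {g : A → N} (hg : g.Injective) {P : N → Prop}
    (hP : ∀ x, P (g x)) {r : A ⊕ N → A ⊕ N → Prop} {r' : N → N → Prop}
    (hNA : ∀ y x, ¬ r (.inr y) (.inl x)) (hAA : ∀ x x', r (.inl x) (.inl x'))
    (hAN : ∀ x y, r (.inl x) (.inr y) ↔ P y)
    (hNN : ∀ y z, r' y z ↔ r (.inr y) (.inr z) ∧ (P y → (∀ x, y ≠ g x) → ∀ x, z ≠ g x))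
    (hbig : ∀ y x, P y → (∀ x, y ≠ g x) → r (.inr y) (.inr (g x)))
    {R : Matrix N N ℂ} (hR : IsRigid r' R) :
    IsRigid r (fromBlocks 0 0 (mapMatrix g) R) := by
  constructor
  · rintro (i | i) (j | j) hij <;> simp only [fromBlocks_apply₁₁, fromBlocks_apply₁₂,
      fromBlocks_apply₂₁, fromBlocks_apply₂₂, Matrix.zero_apply]
    · rw [hAN] at hij
      rw [mapMatrix, if_neg]
      rintro rfl
      exact hij (hP _)
    · exact hR.1 _ _ fun h => hij ((hNN _ _).1 h).1
  intro M hM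
  obtain ⟨X, Y, O, Z, rfl⟩ : ∃ X Y O Z, M = fromBlocks X Y O Z :=
    ⟨_, _, _, _, (fromBlocks_toBlocks M).symm⟩
  obtain ⟨hs, he⟩ := hM
  have hO : O = 0 := by ext y x; exact hs (.inr y) (.inl x) (hNA _ _)
  subst hO
  simp only [fromBlocks_multiply, Matrix.zero_mul, Matrix.mul_zero, add_zero, zero_add] at he
  have hYP : ∀ x y, ¬ P y → Y x y = 0 := fun x y h =>
    hs (.inl x) (.inr y) (by rwa [hAN])
  have hYg : ∀ x x', Y x (g x') = 0 := fun x x' => by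
    have := he (.inl x) (.inl x') (hAA _ _)
    simp only [fromBlocks_apply₁₁, mul_mapMatrix, Matrix.zero_apply] at this
    exact this.symm
  have hXZ : ∀ x x', X x x' = Z (g x) (g x') := fun x x' => by
    have := he (.inr (g x)) (.inl x') ((hAN _ _).2 (hP _))
    simpa only [fromBlocks_apply₂₁, mul_mapMatrix, mapMatrix_mul_apply hg] using this
  have hZ0 : ∀ y x', P y → (∀ x, y ≠ g x) → Z y (g x') = 0 := fun y x' h1 h2 => by
    have := he (.inr y) (.inl x') ((hAN _ _).2 h1)
    simp only [fromBlocks_apply₂₁, mul_mapMatrix, mapMatrix_mul_apply_of_notMem _ h2] at this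
    exact this.symm
  have hNe : ∀ i j, r (.inr j) (.inr i) →
      (mapMatrix g * Y) i j + (R * Z) i j = (Z * R) i j := fun i j hij =>
    he (.inr i) (.inr j) hij
  have hZ : Z ∈ incidenceStabilizer r' R := by
    refine ⟨fun i j hij => ?_, fun i j hij => ?_⟩
    · by_cases h : r (.inr i) (.inr j)
      · rw [hNN] at hij
        push Not at hij
        obtain ⟨h1, h2, x, rfl⟩ := hij h
        exact hZ0 i x h1 h2
      · exact hs (.inr i) (.inr j) h
    · obtain ⟨h1, h2⟩ := (hNN _ _).1 hij
      rw [← hNe i j h1]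
      by_cases hi : ∀ x, i ≠ g x
      · rw [mapMatrix_mul_apply_of_notMem _ hi, zero_add]
      push Not at hi
      obtain ⟨x, rfl⟩ := hi
      rw [mapMatrix_mul_apply hg]
      by_cases hj : P j
      · by_cases hj' : ∀ x, j ≠ g x
        · exact absurd rfl (h2 hj hj' x)
        · push Not at hj'
          obtain ⟨x', rfl⟩ := hj'
          rw [hYg, zero_add]
      · rw [hYP _ _ hj, zero_add]
  have hD := hR.2 Z hZ
  have hZd : Z = diagonal fun i => Z i i := by
    ext i j
    by_cases h : i = j
    · subst h; simp
    · simp [h, hD i j h]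
  rintro (i | i) (j | j) hij
  · exact (hXZ i j).trans (hD _ _ (hg.ne (by simpa using hij)))
  · change Y i j = 0
    by_cases hj : P j
    · by_cases hj' : ∀ x, j ≠ g x
      -- This equation belongs to `r` but not to `r'`, so it has not been used for `Z`. With `Z`
      -- diagonal and `R (g i) j = 0` it reads `Y i j = 0`.
      · have h1 := hNe (g i) j (hbig _ _ hj hj')
        have h2 : R (g i) j = 0 := hR.1 _ _ fun h => ((hNN _ _).1 h).2 hj hj' i rfl
        rw [mapMatrix_mul_apply hg, hZd, mul_diagonal, diagonal_mul, h2] at h1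
        simpa using h1
      · push Not at hj'
        obtain ⟨x', rfl⟩ := hj'
        exact hYg _ _
    · exact hYP _ _ hj
  · rfl
  · exact hD _ _ (by simpa using hij)

/-- The new vertices `C` subdivide the entries of `Q`: what went from `A` to `g c` now goes from `A`
to `c`, and then from `c` to `g c`. Conversely, moving the `A`-to-`C` block of a stabilizing matrix
along `g` gives a stabilizing matrix of the smaller form, which is diagonal; the other off-diagonal
blocks vanish in turn. -/
theorem isRigid_fromBlocks_surjective {g : C → N} (hg : g.Injective)
    {r : (A ⊕ C) ⊕ N → (A ⊕ C) ⊕ N → Prop} {r' : A ⊕ N → A ⊕ N → Prop}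
    (hNA : ∀ y x, ¬ r (.inr y) (.inl x)) (hAA : ∀ x x', r (.inl x) (.inl x'))
    (hAN : ∀ x y, r (.inl x) (.inr y) ↔ ∃ c, y = g c)
    (hAA' : ∀ x x', r' (.inl x) (.inl x'))
    (hAN' : ∀ x y, r' (.inl x) (.inr y) ↔ ∃ c, y = g c)
    (hNN : ∀ y z, r' (.inr y) (.inr z) ↔ r (.inr y) (.inr z))
    (hNA' : ∀ y x, ¬ r' (.inr y) (.inl x))
    {P : Matrix A A ℂ} {Q : Matrix N A ℂ} {R : Matrix N N ℂ}
    (hR : IsRigid r' (fromBlocks P 0 Q R)) :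
    IsRigid r (fromBlocks (fromBlocks P 0 (Q.submatrix g id) 0) 0
      (fromCols 0 (mapMatrix g)) R) := by
  have hQ0 : ∀ y x, (∀ c, y ≠ g c) → Q y x = 0 := fun y x h =>
    hR.1 (.inr y) (.inl x) (by rw [hAN']; push Not; exact h)
  constructor
  · rintro ((i | i) | i) ((j | j) | j) hij <;> first | rfl | exact absurd (hAA _ _) hij | skip
    · rw [hAN] at hij
      push Not at hij
      simp [mapMatrix, hij]
    · exact hR.1 (.inr i) (.inr j) (by rwa [hNN])
  intro M hM
  obtain ⟨X, Y, O, Z, rfl⟩ : ∃ X Y O Z, M = fromBlocks X Y O Z :=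
    ⟨_, _, _, _, (fromBlocks_toBlocks M).symm⟩
  obtain ⟨X0, X1, X2, X3, rfl⟩ : ∃ X0 X1 X2 X3, X = fromBlocks X0 X1 X2 X3 :=
    ⟨_, _, _, _, (fromBlocks_toBlocks X).symm⟩
  obtain ⟨Y0, Y1, rfl⟩ : ∃ Y0 Y1, Y = fromRows Y0 Y1 := ⟨_, _, (fromRows_toRows Y).symm⟩
  obtain ⟨hs, he⟩ := hM
  have hO : O = 0 := by ext y x; exact hs (.inr y) (.inl x) (hNA _ _)
  subst hO
  have hNe : ∀ i j, r (.inr j) (.inr i) →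
      (mapMatrix g * Y1) i j + (R * Z) i j = (Z * R) i j := fun i j hij => by
    simpa [fromBlocks_multiply, fromCols_mul_fromRows] using he (.inr i) (.inr j) hij
  have h00 : P * X0 = X0 * P + X1 * Q.submatrix g id := by
    ext i j
    simpa [fromBlocks_multiply, fromRows_mul_fromCols] using he (.inl (.inl i)) (.inl (.inl j)) (hAA _ _)
  have h01 : P * X1 = Y0 * mapMatrix g := by
    ext i j
    simpa [fromBlocks_multiply, fromRows_mul_fromCols] using he (.inl (.inl i)) (.inl (.inr j)) (hAA _ _)
  have h10 : Q.submatrix g id * X0 = X2 * P + X3 * Q.submatrix g id := by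
    ext i j
    simpa [fromBlocks_multiply, fromRows_mul_fromCols] using he (.inl (.inr i)) (.inl (.inl j)) (hAA _ _)
  have h11 : Q.submatrix g id * X1 = Y1 * mapMatrix g := by
    ext i j
    simpa [fromBlocks_multiply, fromRows_mul_fromCols] using he (.inl (.inr i)) (.inl (.inr j)) (hAA _ _)
  have hX2 : X2 = 0 := by
    ext c a
    have := he (.inr (g c)) (.inl (.inl a)) ((hAN _ _).2 ⟨c, rfl⟩)
    simpa [fromBlocks_multiply, fromCols_mul_fromBlocks, mul_fromCols,
      mapMatrix_mul_apply hg] using this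
  have hX3 : ∀ c c', X3 c c' = Z (g c) (g c') := fun c c' => by
    have := he (.inr (g c)) (.inl (.inr c')) ((hAN _ _).2 ⟨c, rfl⟩)
    simpa [fromBlocks_multiply, fromCols_mul_fromBlocks, mul_fromCols,
      mapMatrix_mul_apply hg, mul_mapMatrix] using this
  subst hX2
  rw [Matrix.zero_mul, zero_add] at h10
  have hYs : ∀ c j, (∀ c', j ≠ g c') → Y1 c j = 0 := fun c j h =>
    hs (.inl (.inr c)) (.inr j) (by rw [hAN]; push Not; exact h)
  have hYs0 : ∀ a j, (∀ c', j ≠ g c') → Y0 a j = 0 := fun a j h =>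
    hs (.inl (.inl a)) (.inr j) (by rw [hAN]; push Not; exact h)
  have hQ : Q = mapMatrix g * Q.submatrix g id := by
    ext y a
    by_cases hy : ∀ c, y ≠ g c
    · rw [mapMatrix_mul_apply_of_notMem _ hy, hQ0 _ _ hy]
    · push Not at hy
      obtain ⟨c, rfl⟩ := hy
      rw [mapMatrix_mul_apply hg]; rfl
  have hXg : ∀ a c, (X1 * (mapMatrix g)ᵀ) a (g c) = X1 a c := fun a c => by
    simp [mul_apply, mapMatrix, hg.eq_iff]
  have hXg0 : ∀ a j, (∀ c, j ≠ g c) → (X1 * (mapMatrix g)ᵀ) a j = 0 := fun a j h => by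
    simp [mul_apply, mapMatrix, h]
  have hGG : (mapMatrix g)ᵀ * mapMatrix g = 1 := by
    ext c c'
    simp [mul_mapMatrix, mapMatrix, one_apply, hg.eq_iff, eq_comm]
  have hM' : fromBlocks X0 (X1 * (mapMatrix g)ᵀ) 0 Z ∈
      incidenceStabilizer r' (fromBlocks P 0 Q R) := by
    refine ⟨?_, ?_⟩
    · rintro (i | i) (j | j) hij
      · exact absurd (hAA' _ _) hij
      · rw [hAN'] at hij
        push Not at hij
        exact hXg0 _ _ hij
      · rfl
      · exact hs (.inr i) (.inr j) (by rwa [← hNN])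
    · rw [fromBlocks_multiply, fromBlocks_multiply]
      rintro (i | i) (j | j) hij
      · have : P * X0 = X0 * P + X1 * (mapMatrix g)ᵀ * Q := by
          rw [hQ, Matrix.mul_assoc, ← Matrix.mul_assoc (mapMatrix g)ᵀ, hGG, Matrix.one_mul, h00]
        simp [this]
      · exact absurd hij (hNA' _ _)
      · rw [hAN'] at hij
        obtain ⟨c, rfl⟩ := hij
        have h1 := congrFun (congrFun h10 c) j
        have h2 : (Q * X0) (g c) j = (Q.submatrix g id * X0) c j := rfl
        simp only [fromBlocks_apply₂₁, Matrix.mul_zero, Matrix.zero_mul, add_zero, zero_add]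
        rw [h2, h1]
        nth_rw 2 [hQ]
        rw [← Matrix.mul_assoc, mul_apply, mul_apply]
        exact Finset.sum_congr rfl fun c' _ => by rw [mul_mapMatrix, hX3]
      · have h1 := hNe i j (by rwa [← hNN])
        simp only [fromBlocks_apply₂₂, Matrix.mul_zero, Matrix.zero_mul, add_zero, zero_add]
        rw [← h1, Matrix.add_apply]
        congr 1
        nth_rw 1 [hQ]
        rw [Matrix.mul_assoc, ← Matrix.mul_assoc (Q.submatrix g id), h11]
        by_cases hi : ∀ c, i ≠ g c
        · rw [mapMatrix_mul_apply_of_notMem _ hi, mapMatrix_mul_apply_of_notMem _ hi]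
        push Not at hi
        obtain ⟨c, rfl⟩ := hi
        rw [mapMatrix_mul_apply hg, mapMatrix_mul_apply hg]
        by_cases hj : ∀ c, j ≠ g c
        · rw [hYs _ _ hj]
          simp [mul_apply, mapMatrix, hj]
        push Not at hj
        obtain ⟨c', rfl⟩ := hj
        rw [← mul_mapMatrix g (Y1 * mapMatrix g * (mapMatrix g)ᵀ), Matrix.mul_assoc, hGG, Matrix.mul_one,
          mul_mapMatrix]
  have hD := hR.2 _ hM'
  have hX1 : X1 = 0 := by
    ext a c
    rw [← hXg]
    exact hD (.inl a) (.inr (g c)) (by simp)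
  subst hX1
  have hY0 : Y0 = 0 := by
    ext a j
    by_cases hj : ∀ c, j ≠ g c
    · exact hYs0 _ _ hj
    push Not at hj
    obtain ⟨c, rfl⟩ := hj
    rw [← mul_mapMatrix g Y0, ← h01, Matrix.mul_zero]; rfl
  have hY1 : Y1 = 0 := by
    ext a j
    by_cases hj : ∀ c, j ≠ g c
    · exact hYs _ _ hj
    push Not at hj
    obtain ⟨c, rfl⟩ := hj
    rw [← mul_mapMatrix g Y1, ← h11, Matrix.mul_zero]; rfl
  subst hY0 hY1
  rintro ((i | i) | i) ((j | j) | j) hij <;> try rfl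
  · exact hD (.inl i) (.inl j) (by simpa using hij)
  · exact (hX3 i j).trans (hD (.inr (g i)) (.inr (g j)) (by simpa using hg.ne (by simpa using hij)))
  · exact hD (.inr i) (.inr j) (by simpa using hij)

/-- The `A` block splits off as a full matrix algebra, in which a diagonal matrix with distinct
entries has only diagonal commutants. -/
theorem isRigid_fromBlocks_diagonal {r : A ⊕ N → A ⊕ N → Prop} {r' : N → N → Prop}
    (hNA : ∀ y x, ¬ r (.inr y) (.inl x)) (hAA : ∀ x x', r (.inl x) (.inl x'))
    (hAN : ∀ x y, ¬ r (.inl x) (.inr y)) (hNN : ∀ y z, r' y z ↔ r (.inr y) (.inr z))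
    {d : A → ℂ} (hd : d.Injective) {R : Matrix N N ℂ} (hR : IsRigid r' R) :
    IsRigid r (fromBlocks (diagonal d) 0 0 R) := by
  constructor
  · rintro (i | i) (j | j) hij <;> first | rfl | exact absurd (hAA _ _) hij | skip
    exact hR.1 i j (by rwa [hNN])
  intro M hM
  obtain ⟨X, Y, O, Z, rfl⟩ : ∃ X Y O Z, M = fromBlocks X Y O Z :=
    ⟨_, _, _, _, (fromBlocks_toBlocks M).symm⟩
  obtain ⟨hs, he⟩ := hM
  rintro (i | i) (j | j) hij
  · have := he (.inl i) (.inl j) (hAA _ _)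
    simp only [fromBlocks_multiply, Matrix.zero_mul, Matrix.mul_zero, add_zero,
      fromBlocks_apply₁₁, diagonal_mul, mul_diagonal] at this
    have h2 : (d i - d j) * X i j = 0 := by linear_combination this
    exact (mul_eq_zero.1 h2).resolve_left (sub_ne_zero.2 (hd.ne (by simpa using hij)))
  · exact hs _ _ (hAN _ _)
  · exact hs _ _ (hNA _ _)
  · refine hR.2 Z ⟨fun i j h => hs (.inr i) (.inr j) (by rwa [← hNN]), fun i j h => ?_⟩ i j
      (by simpa using hij)
    simpa [fromBlocks_multiply] using he (.inr i) (.inr j) (by rwa [← hNN])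

end Steps

/-! ### Compositions, block reversals and seaweeds. -/

/-- The index of the block of the composition `l` that contains `x`. -/
def blockIndex : List ℕ → ℕ → ℕ
  | [], _ => 0
  | a :: l, x => if x < a then 0 else 1 + blockIndex l (x - a)

theorem blockIndex_mono (l : List ℕ) : Monotone (blockIndex l) := by
  induction l with
  | nil => exact fun _ _ _ => le_rfl
  | cons a l ih =>
    intro x y h
    have := ih (Nat.sub_le_sub_right h a)
    simp only [blockIndex]
    split_ifs <;> omega

/-- The involution of `ℕ` that reverses each block of the composition `l`. -/
def blockReverse : List ℕ → ℕ → ℕ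
  | [], x => x
  | a :: l, x => if x < a then a - 1 - x else a + blockReverse l (x - a)

theorem blockReverse_of_lt {a x : ℕ} (l : List ℕ) (h : x < a) :
    blockReverse (a :: l) x = a - 1 - x := if_pos h

theorem blockReverse_of_le {a x : ℕ} (l : List ℕ) (h : a ≤ x) :
    blockReverse (a :: l) x = a + blockReverse l (x - a) := if_neg (Nat.not_lt.2 h)

theorem blockReverse_lt {l : List ℕ} {x : ℕ} (h : x < l.sum) : blockReverse l x < l.sum := by
  induction l generalizing x with
  | nil => exact h
  | cons a l ih =>
    rw [List.sum_cons] at h ⊢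
    rw [blockReverse]
    split_ifs with hx
    · omega
    · have := ih (x := x - a) (by omega)
      omega

theorem blockReverse_blockReverse (l : List ℕ) (x : ℕ) :
    blockReverse l (blockReverse l x) = x := by
  induction l generalizing x with
  | nil => rfl
  | cons a l ih =>
    by_cases hx : x < a
    · have : a - 1 - x < a := by omega
      simp only [blockReverse, if_pos hx, if_pos this]
      omega
    · simp only [blockReverse, if_neg hx, Nat.not_lt.2 (Nat.le_add_right _ _), if_false,
        Nat.add_sub_cancel_left, ih]
      omega

/-- Invariance of a function under the composite of two block reversals of `{0, …, n - 1}`. -/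
def IsReverseInvariant (l l' : List ℕ) (n : ℕ) (φ : ℕ → ℂ) : Prop :=
  ∀ x < n, φ (blockReverse l' (blockReverse l x)) = φ x

theorem IsReverseInvariant.symm {l l' : List ℕ} {n : ℕ} (hl : l.sum = n) (hl' : l'.sum = n)
    {φ : ℕ → ℂ} (h : IsReverseInvariant l l' n φ) : IsReverseInvariant l' l n φ := by
  intro x hx
  have h1 : blockReverse l (blockReverse l' x) < n := by
    have h2 : blockReverse l' x < n := by
      have := blockReverse_lt (l := l') (x := x) (by omega)
      omega
    have := blockReverse_lt (l := l) (x := blockReverse l' x) (by omega)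
    omega
  have := h _ h1
  rwa [blockReverse_blockReverse, blockReverse_blockReverse, eq_comm] at this

/-- The pairs `(i, j)` of positions of the nonzero entries of the seaweed algebra attached to
the two compositions `l` and `l'`. -/
def seaweed (l l' : List ℕ) (n : ℕ) (i j : Fin n) : Prop :=
  blockIndex l i ≤ blockIndex l j ∧ blockIndex l' j ≤ blockIndex l' i

/-- There is a rigid form on the seaweed algebra of `l` and `l'` whose stabilizer is described by
the composite of the block reversals. -/
def HasRigidForm (l l' : List ℕ) (n : ℕ) : Prop :=
  ∃ F : Matrix (Fin n) (Fin n) ℂ, IsRigid (seaweed l l' n) F ∧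
    ∀ φ : ℕ → ℂ, (∀ i j, F i j ≠ 0 → φ i = φ j) ↔ IsReverseInvariant l l' n φ

theorem HasRigidForm.symm {l l' : List ℕ} {n : ℕ} (hl : l.sum = n) (hl' : l'.sum = n)
    (h : HasRigidForm l l' n) : HasRigidForm l' l n := by
  obtain ⟨F, hF, hφ⟩ := h
  refine ⟨Fᵀ, hF.transpose.congr fun i j => and_comm, fun φ => ?_⟩
  rw [show IsReverseInvariant l' l n φ ↔ IsReverseInvariant l l' n φ from
    ⟨fun h => h.symm hl' hl, fun h => h.symm hl hl'⟩, ← hφ]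
  exact ⟨fun h i j hij => (h j i hij).symm, fun h i j hij => (h j i hij).symm⟩

/-! ### Existence of rigid forms by reducing the leading blocks. -/

theorem hasRigidForm_zero (l l' : List ℕ) : HasRigidForm l l' 0 :=
  ⟨0, ⟨fun i => i.elim0, fun _ _ i => i.elim0⟩, fun _ =>
    ⟨fun _ x hx => absurd hx (Nat.not_lt_zero x), fun _ i => i.elim0⟩⟩

theorem HasRigidForm.zero_cons {l l' : List ℕ} {n : ℕ} (h : HasRigidForm l l' n) :
    HasRigidForm (0 :: l) l' n := by
  obtain ⟨F, hF, hφ⟩ := h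
  refine ⟨F, hF.congr fun i j => ?_, fun φ => ?_⟩
  · simp [seaweed, blockIndex]
  · simp [hφ, IsReverseInvariant, blockReverse]

theorem HasRigidForm.cons_cons {t t' : List ℕ} {m : ℕ} (a : ℕ)
    (h : HasRigidForm t t' m) :
    HasRigidForm (a :: t) (a :: t') (a + m) := by
  obtain ⟨R, hR, hφ⟩ := h
  have key := isRigid_fromBlocks_diagonal (A := Fin a)
    (r := fun i j => seaweed (a :: t) (a :: t') (a + m) (finSumFinEquiv i) (finSumFinEquiv j))
    (by simp [seaweed, blockIndex]) (by simp [seaweed, blockIndex])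
    (by simp [seaweed, blockIndex]) (by simp [seaweed, blockIndex])
    (d := fun i => ((i : ℕ) : ℂ)) (fun i j hij => Fin.ext (by simpa using hij)) hR
  refine ⟨_, (key.reindex finSumFinEquiv.symm).congr fun i j => by simp, fun φ => ?_⟩
  have h1 := hφ fun y => φ (a + y)
  constructor
  · intro h x hx
    by_cases hxa : x < a
    · rw [blockReverse_of_lt _ hxa, blockReverse_of_lt _ (by omega)]
      congr 1; omega
    · have h2 := h1.1 (fun i j hij => by
        simpa using h (Fin.natAdd a i) (Fin.natAdd a j) (by simpa using hij)) (x - a) (by omega)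
      have h3 : ¬ a + blockReverse t (x - a) < a := by omega
      simp only [blockReverse, if_neg hxa, if_neg h3]
      rw [Nat.add_sub_cancel_left]
      simpa [Nat.add_sub_cancel' (not_lt.1 hxa)] using h2
  · intro h
    have h2 := h1.2 fun y hy => by
      simpa [blockReverse] using h (a + y) (by omega)
    intro i j
    induction i using Fin.addCases <;> induction j using Fin.addCases
    · rename_i i j
      simp only [submatrix_apply, finSumFinEquiv_symm_apply_castAdd, fromBlocks_apply₁₁,
        diagonal_apply]
      split_ifs with hij
      · intro _; rw [hij]
      · simp
    · simp
    · simp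
    · rename_i i j
      simpa using h2 i j

/-- The composite sends `x < a` to `a + e + x`. Once those positions are glued, reversing the block
`2a + e` has the same effect, as seen by `φ` on later positions, as reversing a block `e` and then a
block `a`. -/
theorem isReverseInvariant_cons_cons_large {t t' : List ℕ} {m : ℕ} (a e : ℕ) (ht : t.sum = m)
    (φ : ℕ → ℂ) :
    IsReverseInvariant (a :: t) ((2 * a + e) :: t') (a + m) φ ↔
      (∀ x < a, φ (a + (e + x)) = φ x) ∧
        IsReverseInvariant t (e :: a :: t') m fun y => φ (a + y) := by
  have h1 : ∀ x < a, blockReverse ((2 * a + e) :: t') (blockReverse (a :: t) x)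
      = a + (e + x) := fun x hx => by
    rw [blockReverse_of_lt _ hx, blockReverse_of_lt _ (by omega)]
    omega
  have h2 : ∀ y, blockReverse (a :: t) (a + y) = a + blockReverse t y := fun y => by
    rw [blockReverse_of_le _ (by omega), Nat.add_sub_cancel_left]
  have h3 : (∀ x < a, φ (a + (e + x)) = φ x) → ∀ z,
      φ (blockReverse ((2 * a + e) :: t') (a + z)) = φ (a + blockReverse (e :: a :: t') z) := by
    intro h z
    by_cases hz : z < e
    · rw [blockReverse_of_lt _ hz, blockReverse_of_lt _ (by omega : a + z < _)]
      congr 1; omega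
    by_cases hz' : z < e + a
    · rw [blockReverse_of_le _ (not_lt.1 hz), blockReverse_of_lt _ (by omega : z - e < a),
        blockReverse_of_lt _ (by omega : a + z < _), ← h _ (by omega : 2 * a + e - 1 - (a + z) < a)]
      congr 1; omega
    · rw [blockReverse_of_le _ (not_lt.1 hz), blockReverse_of_le _ (by omega : a ≤ z - e),
        blockReverse_of_le _ (by omega : _ ≤ a + z), show a + z - (2 * a + e) = z - e - a by omega]
      congr 1; omega
  constructor
  · intro h
    have h4 : ∀ x < a, φ (a + (e + x)) = φ x := fun x hx => by
      rw [← h1 x hx]; exact h x (by omega)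
    refine ⟨h4, fun y hy => ?_⟩
    change φ (a + blockReverse _ _) = φ (a + y)
    rw [← h3 h4, ← h2]
    exact h _ (by omega)
  · rintro ⟨h4, h5⟩ x hx
    by_cases hxa : x < a
    · rw [h1 x hxa, h4 x hxa]
    · obtain ⟨y, rfl⟩ := Nat.exists_eq_add_of_le (not_lt.1 hxa)
      rw [h2, h3 h4]
      exact h5 y (by omega)

theorem HasRigidForm.cons_cons_large {t t' : List ℕ} {m : ℕ} (a e : ℕ) (ht : t.sum = m)
    (ht' : e + a + t'.sum = m) (h : HasRigidForm t (e :: a :: t') m) :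
    HasRigidForm (a :: t) ((2 * a + e) :: t') (a + m) := by
  obtain ⟨R, hR, hφ⟩ := h
  have hsub : ∀ y, a + y - (2 * a + e) = y - e - a := fun y => by omega
  have key := isRigid_fromBlocks_injective (A := Fin a) (N := Fin m)
    (g := fun x => ⟨e + x, by omega⟩) (fun i j hij => Fin.ext (by simpa using hij))
    (P := fun y => (y : ℕ) < e + a) (r := fun i j =>
      seaweed (a :: t) ((2 * a + e) :: t') (a + m) (finSumFinEquiv i) (finSumFinEquiv j))
    (by simp) (by simp [seaweed, blockIndex])
    (by
      intro x x'
      simp only [seaweed, finSumFinEquiv_apply_left, Fin.val_castAdd]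
      simp only [blockIndex]
      split_ifs <;> omega)
    (by
      intro x y
      simp only [seaweed, finSumFinEquiv_apply_left, finSumFinEquiv_apply_right,
        Fin.val_castAdd, Fin.val_natAdd]
      simp only [blockIndex]
      split_ifs <;> omega)
    (by
      intro y z
      have hrange : ∀ y : Fin m, (∀ x : Fin a, y ≠ ⟨e + x, by omega⟩) ↔
          ¬ (e ≤ (y : ℕ) ∧ (y : ℕ) < e + a) := by
        intro y
        constructor
        · rintro h ⟨h1, h2⟩
          exact h ⟨y - e, by omega⟩ (Fin.ext (by simp; omega))
        · rintro h x rfl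
          exact h ⟨by simp, by simp⟩
      rw [hrange, hrange]
      simp only [seaweed, finSumFinEquiv_apply_right, Fin.val_natAdd]
      simp only [blockIndex, hsub,
        Nat.add_sub_cancel_left]
      split_ifs <;> omega)
    (by
      intro y x h1 h2
      have h3 : (y : ℕ) < e := by
        by_contra h3
        exact h2 ⟨y - e, by omega⟩ (Fin.ext (by simp; omega))
      simp only [seaweed, finSumFinEquiv_apply_right, Fin.val_natAdd]
      refine ⟨?_, ?_⟩
      · have := blockIndex_mono t (show (y : ℕ) ≤ e + x by omega)
        simp only [blockIndex, Nat.add_sub_cancel_left]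
        split_ifs <;> omega
      · simp only [blockIndex]
        split_ifs <;> omega) hR
  refine ⟨_, (key.reindex finSumFinEquiv.symm).congr fun i j => by simp, fun φ => ?_⟩
  rw [isReverseInvariant_cons_cons_large a e ht, ← hφ]
  constructor
  · intro h
    refine ⟨fun x hx => ?_, fun i j hij => ?_⟩
    · refine h (Fin.natAdd a ⟨e + x, by omega⟩) (Fin.castAdd m ⟨x, hx⟩) ?_
      rw [submatrix_apply, finSumFinEquiv_symm_apply_natAdd, finSumFinEquiv_symm_apply_castAdd]
      simp [mapMatrix]
    · simpa using h (Fin.natAdd a i) (Fin.natAdd a j) (by simpa using hij)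
  · rintro ⟨h, h'⟩ i j
    induction i using Fin.addCases <;> induction j using Fin.addCases
    · simp
    · simp
    · rename_i i j
      intro hij
      simp [mapMatrix] at hij
      simp [hij, h j j.2]
    · rename_i i j
      simpa using h' i j

/-- The composite sends `x < a + k` to `x + k`. Gluing the positions `a + c` and `a + k + c` for `c
< k` makes the interval from `a` to `a + k` redundant, and deleting it leaves the smaller pair of
compositions. -/
theorem isReverseInvariant_cons_cons_small {t t' : List ℕ} {m : ℕ} (a k : ℕ) (ht : t.sum = m)
    (hk : k ≤ m) (φ : ℕ → ℂ) :
    IsReverseInvariant ((a + k) :: t) ((a + k + k) :: t') (a + k + m) φ ↔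
      (∀ c < k, φ (a + c) = φ (a + k + c)) ∧
        IsReverseInvariant (a :: t) ((a + k) :: t') (a + m)
          fun y => if y < a then φ y else φ (y + k) := by
  set ψ : ℕ → ℂ := fun y => if y < a then φ y else φ (y + k) with hψ
  have hlt : ∀ y < a, ψ y = φ y := fun y hy => if_pos hy
  have hge : ∀ y, a ≤ y → ψ y = φ (y + k) := fun y hy => if_neg (not_lt.2 hy)
  have h1 : ∀ x < a + k, blockReverse ((a + k + k) :: t') (blockReverse ((a + k) :: t) x)
      = x + k := fun x hx => by
    rw [blockReverse_of_lt _ hx, blockReverse_of_lt _ (by omega)]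
    omega
  have h2 : ∀ x < a, blockReverse ((a + k) :: t') (blockReverse (a :: t) x) = x + k :=
    fun x hx => by
      rw [blockReverse_of_lt _ hx, blockReverse_of_lt _ (by omega)]
      omega
  have h0 : (∀ c < k, φ (a + c) = φ (a + k + c)) → ∀ x < a + k, ψ x = φ x := by
    intro h x hx
    by_cases hxa : x < a
    · exact hlt x hxa
    · obtain ⟨c, rfl⟩ := Nat.exists_eq_add_of_le (not_lt.1 hxa)
      rw [hge _ (by omega), h c (by omega)]
      congr 1; omega
  have h3 : ∀ y, blockReverse ((a + k) :: t) (a + k + y) = a + k + blockReverse t y := fun y => by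
    rw [blockReverse_of_le _ (by omega), Nat.add_sub_cancel_left]
  have h4 : ∀ y, blockReverse (a :: t) (a + y) = a + blockReverse t y := fun y => by
    rw [blockReverse_of_le _ (by omega), Nat.add_sub_cancel_left]
  have h5 : (∀ c < k, φ (a + c) = φ (a + k + c)) → ∀ z,
      ψ (blockReverse ((a + k) :: t') (a + z)) =
        φ (blockReverse ((a + k + k) :: t') (a + k + z)) := by
    intro h z
    by_cases hz : z < k
    · rw [blockReverse_of_lt _ (by omega), blockReverse_of_lt _ (by omega), h0 h _ (by omega)]
      congr 1; omega
    · rw [blockReverse_of_le _ (by omega), blockReverse_of_le _ (by omega), hge _ (by omega),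
        show a + k + z - (a + k + k) = a + z - (a + k) by omega]
      congr 1; omega
  constructor
  · intro h
    have hH : ∀ c < k, φ (a + c) = φ (a + k + c) := fun c hc => by
      rw [← h (a + c) (by omega), h1 _ (by omega)]
      congr 1; omega
    refine ⟨hH, fun x hx => ?_⟩
    by_cases hxa : x < a
    · have h6 : ψ (x + k) = φ (x + k) := h0 hH _ (by omega)
      rw [h2 x hxa, h6, h0 hH _ (by omega), ← h1 x (by omega), h x (by omega)]
    · obtain ⟨y, rfl⟩ := Nat.exists_eq_add_of_le (not_lt.1 hxa)
      rw [h4, h5 hH, ← h3, h _ (by omega), hge _ (by omega)]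
      congr 1; omega
  · rintro ⟨hH, h⟩ x hx
    by_cases hxa : x < a
    · rw [h1 x (by omega), ← h0 hH _ (by omega), ← h0 hH x (by omega), ← h2 x hxa, h x (by omega)]
    by_cases hxk : x < a + k
    · obtain ⟨c, rfl⟩ := Nat.exists_eq_add_of_le (not_lt.1 hxa)
      rw [h1 _ hxk, hH c (by omega)]
      congr 1; omega
    · obtain ⟨y, rfl⟩ := Nat.exists_eq_add_of_le (not_lt.1 hxk)
      rw [h3, ← h5 hH, ← h4, h _ (by omega), hge _ (by omega)]
      congr 1; omega

theorem HasRigidForm.cons_cons_small {t t' : List ℕ} {m : ℕ} (a k : ℕ) (ht : t.sum = m)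
    (ht' : k + t'.sum = m) (h : HasRigidForm (a :: t) ((a + k) :: t') (a + m)) :
    HasRigidForm ((a + k) :: t) ((a + k + k) :: t') (a + k + m) := by
  obtain ⟨F, hF, hφ⟩ := h
  have hF' := hF.reindex finSumFinEquiv
  set G := F.submatrix finSumFinEquiv finSumFinEquiv with hG
  have hG0 : G.toBlocks₁₂ = 0 := by
    ext i j
    exact hF'.1 (.inl i) (.inr j) (by simp [seaweed, blockIndex])
  rw [← fromBlocks_toBlocks G, hG0] at hF'
  have hgmem : ∀ y : Fin m, (∃ c : Fin k, y = Fin.castLE (by omega) c) ↔ (y : ℕ) < k := by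
    intro y
    constructor
    · rintro ⟨c, rfl⟩; exact c.2
    · intro h; exact ⟨⟨y, h⟩, rfl⟩
  have hsub : ∀ y, a + k + y - (a + k + k) = y - k := fun y => by omega
  have hsub' : ∀ y, a + y - (a + k) = y - k := fun y => by omega
  have key := isRigid_fromBlocks_surjective (A := Fin a) (C := Fin k) (N := Fin m)
    (g := Fin.castLE (by omega)) (Fin.castLE_injective _) (r := fun i j =>
      seaweed ((a + k) :: t) ((a + k + k) :: t') (a + k + m)
        (finSumFinEquiv (i.map finSumFinEquiv id)) (finSumFinEquiv (j.map finSumFinEquiv id)))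
    (by
      intro y x
      simp [seaweed, blockIndex])
    (by
      intro x x'
      simp only [seaweed, Sum.map_inl, finSumFinEquiv_apply_left, Fin.val_castAdd]
      simp only [blockIndex]
      split_ifs <;> omega)
    (by
      intro x y
      rw [hgmem]
      simp only [seaweed, finSumFinEquiv_apply_left, finSumFinEquiv_apply_right,
        Fin.val_castAdd, Fin.val_natAdd, Sum.map_inl, Sum.map_inr, id]
      simp only [blockIndex]
      split_ifs <;> omega)
    (by
      intro x x'
      simp only [seaweed, finSumFinEquiv_apply_left, Fin.val_castAdd]
      simp only [blockIndex]
      split_ifs <;> omega)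
    (by
      intro x y
      rw [hgmem]
      simp only [seaweed, finSumFinEquiv_apply_left, finSumFinEquiv_apply_right,
        Fin.val_castAdd, Fin.val_natAdd]
      simp only [blockIndex]
      split_ifs <;> omega)
    (by
      intro y z
      simp only [seaweed, finSumFinEquiv_apply_right,
        Fin.val_natAdd, Sum.map_inr, id]
      simp only [blockIndex, hsub, hsub', Nat.add_sub_cancel_left]
      split_ifs <;> omega)
    (by
      intro y x
      simp [seaweed, blockIndex]) hF'
  refine ⟨_, (key.reindex (finSumFinEquiv.symm.trans
    (Equiv.sumCongr finSumFinEquiv.symm (Equiv.refl _)))).congr fun i j => by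
      simp [Sum.map_map], fun φ => ?_⟩
  rw [isReverseInvariant_cons_cons_small a k ht (by omega), ← hφ]
  have hψ : ∀ y : Fin m, (if a + (y : ℕ) < a then φ (a + y) else φ (a + y + k)) =
      φ (a + k + y) := fun y => by
    rw [if_neg (by omega)]
    congr 1; omega
  set E := finSumFinEquiv.symm.trans
    (Equiv.sumCongr (finSumFinEquiv (m := a) (n := k)).symm (Equiv.refl (Fin m))) with hE
  have hF1 : (∀ i j, F i j ≠ 0 → (if (i : ℕ) < a then φ i else φ (i + k)) =
      if (j : ℕ) < a then φ j else φ (j + k)) ↔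
      ∀ s s', G s s' ≠ 0 → Sum.elim (fun x : Fin a => φ x) (fun y : Fin m => φ (a + k + y)) s =
        Sum.elim (fun x : Fin a => φ x) (fun y : Fin m => φ (a + k + y)) s' := by
    have hval : ∀ s, (if (finSumFinEquiv s : ℕ) < a then φ (finSumFinEquiv s : ℕ)
        else φ (finSumFinEquiv s + k : ℕ)) =
        Sum.elim (fun x : Fin a => φ x) (fun y : Fin m => φ (a + k + y)) s := by
      rintro (x | y)
      · simp
      · simpa using hψ y
    constructor
    · intro h s s' hs
      rw [← hval, ← hval]
      exact h _ _ hs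
    · intro h i j hij
      obtain ⟨s, rfl⟩ := finSumFinEquiv.surjective i
      obtain ⟨s', rfl⟩ := finSumFinEquiv.surjective j
      rw [hval, hval]
      exact h _ _ hij
  rw [hF1]
  set w : (Fin a ⊕ Fin k) ⊕ Fin m → ℂ := Sum.elim (Sum.elim (fun x => φ x) fun c => φ (a + c))
    fun y => φ (a + k + y) with hw
  have hval : ∀ i : Fin (a + k + m), φ (i : ℕ) = w (E i) := by
    intro i
    obtain ⟨s, rfl⟩ := E.symm.surjective i
    rw [Equiv.apply_symm_apply]
    rcases s with (x | c) | y <;> simp [hE, hw]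
  have hF2 : (∀ i j, (fromBlocks (fromBlocks G.toBlocks₁₁ 0 (G.toBlocks₂₁.submatrix
        (Fin.castLE (by omega : k ≤ m)) id) 0) 0 (fromCols 0 (mapMatrix (Fin.castLE (by omega))))
        G.toBlocks₂₂).submatrix E E i j ≠ 0 → φ i = φ j) ↔
      ∀ s s', fromBlocks (fromBlocks G.toBlocks₁₁ 0 (G.toBlocks₂₁.submatrix
        (Fin.castLE (by omega : k ≤ m)) id) 0) 0 (fromCols 0 (mapMatrix (Fin.castLE (by omega))))
        G.toBlocks₂₂ s s' ≠ 0 → w s = w s' := by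
    constructor
    · intro h s s' hs
      have := h (E.symm s) (E.symm s') (by simpa using hs)
      rwa [hval, hval, E.apply_symm_apply, E.apply_symm_apply] at this
    · intro h i j hij
      rw [hval, hval]
      exact h _ _ hij
  rw [hF2]
  constructor
  · intro h
    have hH : ∀ c < k, φ (a + c) = φ (a + k + c) := fun c hc => by
      refine (h (.inr ⟨c, by omega⟩) (.inl (.inr ⟨c, hc⟩)) ?_).symm
      simp [mapMatrix]
    refine ⟨hH, ?_⟩
    rintro (x | y) (x' | y') hs
    · exact h (.inl (.inl x)) (.inl (.inl x')) hs
    · exact absurd (congrFun (congrFun hG0 x) y') hs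
    · have hy : ∃ c : Fin k, y = Fin.castLE (by omega) c := by
        rw [hgmem]
        by_contra hy
        refine hs (hF'.1 (.inr y) (.inl x') ?_)
        simp only [seaweed, finSumFinEquiv_apply_left, finSumFinEquiv_apply_right,
          Fin.val_castAdd, Fin.val_natAdd]
        simp only [blockIndex]
        split_ifs <;> omega
      obtain ⟨c, rfl⟩ := hy
      exact (hH c c.2).symm.trans (h (.inl (.inr c)) (.inl (.inl x')) hs)
    · exact h (.inr y) (.inr y') hs
  · rintro ⟨hH, h⟩ ((x | c) | y) ((x' | c') | y') hs
    · exact h (.inl x) (.inl x') hs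
    · exact absurd rfl hs
    · exact absurd rfl hs
    · exact (hH c c.2).trans (h (.inr (Fin.castLE (by omega) c)) (.inl x') hs)
    · exact absurd rfl hs
    · exact absurd rfl hs
    · exact absurd rfl hs
    · have hy : y = Fin.castLE (by omega) c' := by
        by_contra hy
        exact hs (if_neg hy)
      subst hy
      exact (hH c' c'.2).symm
    · exact h (.inr y) (.inr y') hs

/-- Euclid on the leading blocks `a ≤ b`: cancel them if equal, replace `b` by `b - 2a, a` and drop
`a` if `2a ≤ b`, and otherwise shrink both by `b - a`. -/
theorem hasRigidForm (l l' : List ℕ) {n : ℕ} (hl : l.sum = n) (hl' : l'.sum = n) :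
    HasRigidForm l l' n := by
  -- The lengths are part of the measure so that dropping a zero block also decreases it; when `b`
  -- is split, the two lengths have unchanged sum and `n` drops.
  induction hN : n + l.length + l'.length using Nat.strong_induction_on generalizing l l' n with
  | _ N ih =>
  wlog hle : l.headI ≤ l'.headI generalizing l l'
  · exact (this l' l hl' hl (by omega) (by omega)).symm hl' hl
  subst hN
  match l, l' with
  | [], _ => rw [← hl]; exact hasRigidForm_zero _ _
  | _, [] => rw [← hl']; exact hasRigidForm_zero _ _
  | 0 :: t, l' =>
    exact (ih _ (by simp) t l' (by simpa using hl) hl' rfl).zero_cons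
  | (a + 1) :: t, b :: t' =>
    simp only [List.headI_cons, List.sum_cons, List.length_cons] at hle hl hl' ih
    by_cases hab : a + 1 = b
    · subst hab hl
      exact (ih _ (by omega) t t' rfl (by omega) rfl).cons_cons _
    by_cases hab' : 2 * (a + 1) ≤ b
    · obtain ⟨e, rfl⟩ := Nat.exists_eq_add_of_le hab'
      subst hl
      exact (ih _ (by simp; omega) t (e :: (a + 1) :: t') rfl (by simp; omega) rfl).cons_cons_large
        _ _ rfl (by omega)
    · obtain ⟨k, rfl⟩ := Nat.exists_eq_add_of_le hle
      obtain ⟨c, hc⟩ := Nat.exists_eq_add_of_le (show k ≤ a + 1 by omega)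
      rw [add_comm k c] at hc
      rw [hc] at hl ⊢
      rw [hc] at hl'
      subst hl
      exact (ih _ (by simp; omega) (c :: t) ((c + k) :: t') (by simp) (by simp; omega)
        rfl).cons_cons_small _ _ rfl (by omega)

/-! ### A rigid form minimizes the dimension of the stabilizer. -/

open Filter Topology in
/-- If the infinitesimal conjugates of `f` by elements of the range of `p`, together with the ranges
of `s` and `k`, span `R`, then all elements near `f` are conjugate to an element of `f + range s`,
modulo the range of `k`, by a unit in `1 + range p`. -/
theorem eventually_exists_conj {R : Type*} [NormedRing R] [NormedAlgebra ℂ R] [CompleteSpace R]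
    (f : R) (p s k : R →L[ℂ] R) (h : ∀ y, ∃ X D K, p X * f - f * p X + s D + k K = y) :
    ∀ᶠ y in 𝓝 f, ∃ X D K, IsUnit (1 + p X) ∧
      y = (1 + p X) * (f + s D) * Ring.inverse (1 + p X) + k K := by
  let π₁ := ContinuousLinearMap.fst ℂ R (R × R)
  let π₂ := (ContinuousLinearMap.fst ℂ R R).comp (ContinuousLinearMap.snd ℂ R (R × R))
  let π₃ := (ContinuousLinearMap.snd ℂ R R).comp (ContinuousLinearMap.snd ℂ R (R × R))
  have hg : HasStrictFDerivAt (fun z : R × R × R => 1 + p z.1) (p.comp π₁) 0 :=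
    (p.comp π₁).hasStrictFDerivAt.const_add 1
  have hs : HasStrictFDerivAt (fun z : R × R × R => f + s z.2.1) (s.comp π₂) 0 :=
    (s.comp π₂).hasStrictFDerivAt.const_add f
  have hk : HasStrictFDerivAt (fun z : R × R × R => k z.2.2) (k.comp π₃) 0 :=
    (k.comp π₃).hasStrictFDerivAt
  have h1 : (fun z : R × R × R => 1 + p z.1) 0 = ((1 : Rˣ) : R) := by simp
  have hi := (h1 ▸ hasStrictFDerivAt_ringInverse (𝕜 := ℂ) (1 : Rˣ)).comp
    (0 : R × R × R) hg
  have hΨ := ((hg.mul' hs).mul' hi).add hk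
  -- The derivative at `0` is `(X, D, K) ↦ p X * f - f * p X + s D + k K`, surjective by `h`, so the
  -- map is open at `0`.
  have hmap := hΨ.map_nhds_eq_of_surj (by
    rw [LinearMap.range_eq_top]
    intro y
    obtain ⟨X, D, K, rfl⟩ := h y
    refine ⟨(X, D, K), ?_⟩
    simp [π₁, π₂, π₃]
    abel)
  have hval : (1 + p (0 : R × R × R).1) * (f + s (0 : R × R × R).2.1) *
      Ring.inverse (1 + p (0 : R × R × R).1) + k (0 : R × R × R).2.2 = f := by simp
  have hU : ∀ᶠ z in 𝓝 (0 : R × R × R), IsUnit (1 + p z.1) := by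
    have : Tendsto (fun z : R × R × R => 1 + p z.1) (𝓝 0) (𝓝 ((1 : Rˣ) : R)) := by
      rw [← h1]
      exact hg.continuousAt
    exact this.eventually (Units.nhds 1)
  have := Filter.image_mem_map (m := fun z : R × R × R => (1 + p z.1) * (f + s z.2.1) *
      Ring.inverse (1 + p z.1) + k z.2.2) hU
  rw [show Filter.map (fun z : R × R × R => (1 + p z.1) * (f + s z.2.1) *
      Ring.inverse (1 + p z.1) + k z.2.2) (𝓝 0) = 𝓝 f from by
    refine Eq.trans hmap (congrArg 𝓝 hval)] at this
  filter_upwards [this]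
  rintro _ ⟨⟨X, D, K⟩, hz, rfl⟩
  exact ⟨X, D, K, hz, rfl⟩

open Filter Topology in
/-- Along a line of linear maps, the dimension of the kernel is upper semicontinuous. -/
theorem eventually_finrank_ker_add_smul_le {V W : Type*} [AddCommGroup V] [Module ℂ V]
    [FiniteDimensional ℂ V] [AddCommGroup W] [Module ℂ W] (S T : V →ₗ[ℂ] W) :
    ∀ᶠ ε in 𝓝[≠] (0 : ℂ), Module.finrank ℂ (LinearMap.ker (T + ε • S)) ≤
      Module.finrank ℂ (LinearMap.ker S) := by
  obtain ⟨C, hC⟩ := (LinearMap.ker S).exists_isCompl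
  have hinj : Function.Injective (S ∘ₗ C.subtype) := by
    rw [← LinearMap.ker_eq_bot, LinearMap.ker_comp]
    exact Submodule.disjoint_iff_comap_eq_bot.1 hC.disjoint.symm
  obtain ⟨Q, hQ⟩ := LinearMap.exists_leftInverse_of_injective _ (LinearMap.ker_eq_bot.2 hinj)
  -- A kernel vector of `T + ε • S` lying in the complement `C` is an eigenvector of `N` for `-ε`;
  -- only finitely many `ε` allow this.
  let N : Module.End ℂ C := Q ∘ₗ T ∘ₗ C.subtype
  have hfin : {ε : ℂ | N.HasEigenvalue (-ε)}.Finite :=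
    N.finite_hasEigenvalue.preimage neg_injective.injOn
  have hev : ∀ᶠ ε in 𝓝[≠] (0 : ℂ), ¬ N.HasEigenvalue (-ε) := by
    have h1 : ({ε : ℂ | N.HasEigenvalue (-ε)} \ {0})ᶜ ∈ 𝓝 (0 : ℂ) :=
      (hfin.subset Set.sdiff_subset).isClosed.isOpen_compl.mem_nhds (by simp)
    filter_upwards [mem_nhdsWithin_of_mem_nhds h1, self_mem_nhdsWithin] with ε h2 h3 h4
    exact h2 ⟨h4, h3⟩
  filter_upwards [hev] with ε hε
  have hdisj : Disjoint (LinearMap.ker (T + ε • S)) C := by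
    rw [Submodule.disjoint_def]
    intro x hx hxC
    by_contra h0
    refine hε (Module.End.hasEigenvalue_of_hasEigenvector (x := ⟨x, hxC⟩) ⟨?_, by simpa using h0⟩)
    rw [Module.End.mem_eigenspace_iff]
    have h1 : T x = - (ε • S x) := by
      rw [LinearMap.mem_ker] at hx
      exact eq_neg_of_add_eq_zero_left hx
    have h2 : Q (S x) = ⟨x, hxC⟩ := LinearMap.congr_fun hQ ⟨x, hxC⟩
    simp [N, h1, h2]
  have h1 := Submodule.finrank_add_finrank_le_of_disjoint hdisj
  have h2 := Submodule.finrank_add_eq_of_isCompl hC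
  omega

section Regular

set_option linter.unusedSectionVars false

variable {ι : Type*} [Fintype ι] [DecidableEq ι]

/-- The projection of matrices onto the entries at positions in `r`. -/
noncomputable def entryProj (r : ι → ι → Prop) : Matrix ι ι ℂ →ₗ[ℂ] Matrix ι ι ℂ := by
  classical exact
  { toFun M := of fun i j => if r i j then M i j else 0
    map_add' M N := by ext i j; simp only [of_apply, Matrix.add_apply]; split_ifs <;> simp
    map_smul' c M := by ext i j; simp }

theorem entryProj_apply (r : ι → ι → Prop) [DecidableRel r] (M : Matrix ι ι ℂ) (i j : ι) :
    entryProj r M i j = if r i j then M i j else 0 := by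
  simp only [entryProj, LinearMap.coe_mk, AddHom.coe_mk, of_apply]
  congr

theorem entryProj_single {r : ι → ι → Prop} {i j : ι} (h : r i j) :
    entryProj r (single i j 1) = single i j 1 := by
  classical
  ext i' j'
  rw [entryProj_apply]
  split_ifs with h'
  · rfl
  · rw [single_apply, if_neg]
    rintro ⟨rfl, rfl⟩
    exact h' h

/-- The functions on the vertices of the graph of `F` that are constant on edges. -/
def edgeInvariants (F : Matrix ι ι ℂ) : Submodule ℂ (ι → ℂ) where
  carrier := {φ | ∀ i j, F i j ≠ 0 → φ i = φ j}
  zero_mem' := by simp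
  add_mem' {φ ψ} hφ hψ i j h := by simp [hφ i j h, hψ i j h]
  smul_mem' c φ hφ i j h := by simp [hφ i j h]

theorem mem_edgeInvariants_iff {F : Matrix ι ι ℂ} {φ : ι → ℂ} :
    φ ∈ edgeInvariants F ↔ F * diagonal φ = diagonal φ * F := by
  constructor
  · intro h
    ext i j
    rw [mul_diagonal, diagonal_mul]
    by_cases hF : F i j = 0
    · simp [hF]
    · rw [h i j hF, mul_comm]
  · intro h i j hF
    have := congrFun (congrFun h i) j
    rw [mul_diagonal, diagonal_mul, mul_comm] at this
    exact (mul_right_cancel₀ hF this).symm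

theorem eq_trace_mul (g : Matrix ι ι ℂ →ₗ[ℂ] ℂ) (M : Matrix ι ι ℂ) :
    g M = trace ((of fun i j => g (single j i 1)) * M) := by
  conv_lhs => rw [matrix_eq_sum_single M]
  simp only [map_sum, trace, diag, mul_apply]
  rw [Finset.sum_comm]
  refine Finset.sum_congr rfl fun i _ => Finset.sum_congr rfl fun j _ => ?_
  rw [← mul_one (M j i), ← smul_eq_mul, ← smul_single, map_smul, smul_eq_mul, mul_comm]
  simp

variable {α : ι → ℕ} {F : Matrix ι ι ℂ}

/-- Duality: a functional `tr (Z * ·)` killing the span has `Z` block triangular (from `K`),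
stabilizing `F` (from `X`) and with zero diagonal (from `D`). Rigidity makes `Z` diagonal, hence
zero. -/
theorem IsRigid.exists_infinitesimal_conj (hF : IsRigid (fun i j => α i ≤ α j) F)
    (y : Matrix ι ι ℂ) :
    ∃ X D K, entryProj (fun i j => α i ≤ α j) X * F - F * entryProj (fun i j => α i ≤ α j) X +
      entryProj (fun i j => ∀ φ ∈ edgeInvariants F, φ i = φ j) D +
      entryProj (fun i j => α i < α j) K = y := by
  let p := entryProj (fun i j => α i ≤ α j)
  let T : Matrix ι ι ℂ × Matrix ι ι ℂ × Matrix ι ι ℂ →ₗ[ℂ] Matrix ι ι ℂ :=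
    ((LinearMap.mulRight ℂ F - LinearMap.mulLeft ℂ F) ∘ₗ p).coprod
      ((entryProj (fun i j => ∀ φ ∈ edgeInvariants F, φ i = φ j)).coprod
        (entryProj (fun i j => α i < α j)))
  suffices h : LinearMap.range T = ⊤ by
    obtain ⟨⟨X, D, K⟩, rfl⟩ := LinearMap.range_eq_top.1 h y
    exact ⟨X, D, K, by simp [T, p, add_assoc]⟩
  by_contra hT
  obtain ⟨g, hg0, hg⟩ := Submodule.exists_le_ker_of_lt_top _ (lt_top_iff_ne_top.2 hT)
  let Z : Matrix ι ι ℂ := of fun i j => g (single j i 1)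
  have hgZ : ∀ M, g M = trace (Z * M) := eq_trace_mul g
  have hgT : ∀ z, g (T z) = 0 := fun z => hg ⟨z, rfl⟩
  have hsingle : ∀ (M : Matrix ι ι ℂ) i j, trace (M * single i j 1) = M j i := fun M i j => by
    simp [trace, mul_apply, single_apply, ite_and]
  have hZs : Z ∈ incidenceStabilizer (fun i j => α i ≤ α j) F := by
    refine ⟨fun i j hij => ?_, fun i j hij => ?_⟩
    · have h := hgT (0, 0, single j i 1)
      simpa [T, entryProj_single (r := fun i j => α i < α j) (not_le.1 hij), Z] using h
    · have h := hgT (single j i 1, 0, 0)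
      simp only [T, p, LinearMap.coprod_apply, LinearMap.comp_apply, map_zero, add_zero,
        LinearMap.sub_apply, LinearMap.mulRight_apply, LinearMap.mulLeft_apply,
        entryProj_single (r := fun i j => α i ≤ α j) hij, hgZ, Matrix.mul_sub, trace_sub] at h
      rw [← Matrix.mul_assoc, trace_mul_comm, ← Matrix.mul_assoc, ← Matrix.mul_assoc, hsingle,
        hsingle] at h
      exact sub_eq_zero.1 h
  refine hg0 ?_
  have hZ0 : Z = 0 := by
    ext i j
    by_cases hij : i = j
    · subst hij
      have h := hgT (0, single i i 1, 0)
      simpa [T, entryProj_single (r := fun i j => ∀ φ ∈ edgeInvariants F, φ i = φ j)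
        (show ∀ φ ∈ edgeInvariants F, φ i = φ i from fun _ _ => rfl), Z] using h
    · exact hF.2 Z hZs i j hij
  ext M
  simp [hgZ, hZ0]

/-- The linear map whose kernel is the stabilizer of `F` in block triangular matrices. -/
noncomputable def commutatorMap (α : ι → ℕ) (F : Matrix ι ι ℂ) :
    Matrix ι ι ℂ →ₗ[ℂ] Matrix ι ι ℂ × Matrix ι ι ℂ :=
  (entryProj fun i j => α j < α i).prod
    (entryProj (fun i j => α j ≤ α i) ∘ₗ (LinearMap.mulLeft ℂ F - LinearMap.mulRight ℂ F))

theorem ker_commutatorMap (α : ι → ℕ) (F : Matrix ι ι ℂ) :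
    LinearMap.ker (commutatorMap α F) = incidenceStabilizer (fun i j => α i ≤ α j) F := by
  ext M
  rw [LinearMap.mem_ker]
  refine Prod.mk_eq_zero.trans ?_
  refine and_congr ?_ ?_
  · rw [← Matrix.ext_iff]
    refine forall₂_congr fun i j => ?_
    rw [entryProj_apply]
    simp
  · rw [← Matrix.ext_iff]
    refine forall₂_congr fun i j => ?_
    rw [LinearMap.comp_apply, entryProj_apply]
    simp [sub_eq_zero]

theorem mul_apply_eq_zero_of_strict {K M : Matrix ι ι ℂ} (hK : ∀ i j, ¬ α i < α j → K i j = 0)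
    (hM : BlockTriangular M α) (i j : ι) (hij : ¬ α i < α j) :
    (K * M) i j = 0 ∧ (M * K) i j = 0 := by
  simp only [mul_apply]
  refine ⟨Finset.sum_eq_zero fun l _ => ?_, Finset.sum_eq_zero fun l _ => ?_⟩
  · by_cases h : α i < α l
    · rw [hM (i := l) (j := j) (by omega), mul_zero]
    · rw [hK _ _ h, zero_mul]
  · by_cases h : α l < α j
    · rw [hM (i := i) (j := l) (by omega), zero_mul]
    · rw [hK _ _ h, mul_zero]

/-- The diagonal matrices with entries in `edgeInvariants F` commute with `D`, so their conjugates
by `G` commute with the conjugate of `D`. They are block triangular, and the strictly triangular `K`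
does not contribute to the stabilizer equations. -/
theorem finrank_edgeInvariants_le_of_conj {G D K : Matrix ι ι ℂ} (hG : IsUnit G)
    (hGt : BlockTriangular G α) (hD : ∀ φ ∈ edgeInvariants F, D * diagonal φ = diagonal φ * D)
    (hK : ∀ i j, ¬ α i < α j → K i j = 0) :
    Module.finrank ℂ (edgeInvariants F) ≤
      Module.finrank ℂ (incidenceStabilizer (fun i j => α i ≤ α j)
        (G * D * Ring.inverse G + K)) := by
  obtain ⟨u, rfl⟩ := hG
  rw [Ring.inverse_unit]
  have hinv : BlockTriangular ((u⁻¹ : (Matrix ι ι ℂ)ˣ) : Matrix ι ι ℂ) α := by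
    have := u.invertible
    rw [coe_units_inv]
    exact blockTriangular_inv_of_blockTriangular hGt
  let T : (ι → ℂ) →ₗ[ℂ] Matrix ι ι ℂ :=
    LinearMap.mulRight ℂ ((u⁻¹ : (Matrix ι ι ℂ)ˣ) : Matrix ι ι ℂ) ∘ₗ
      LinearMap.mulLeft ℂ (u : Matrix ι ι ℂ) ∘ₗ diagonalLinearMap ι ℂ ℂ
  have hTφ : ∀ φ, T φ = u * diagonal φ * (u⁻¹ : (Matrix ι ι ℂ)ˣ) := fun φ => rfl
  have hT : Function.Injective T := by
    intro φ ψ h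
    rw [hTφ, hTφ] at h
    rw [Units.mul_left_inj, Units.mul_right_inj] at h
    exact diagonal_injective h
  have hle : (edgeInvariants F).map T ≤ incidenceStabilizer (fun i j => α i ≤ α j)
      (u * D * (u⁻¹ : (Matrix ι ι ℂ)ˣ) + K) := by
    rintro _ ⟨φ, hφ, rfl⟩
    have hM : BlockTriangular (T φ) α := (hGt.mul (blockTriangular_diagonal φ)).mul hinv
    refine ⟨fun i j h => hM (not_le.1 h), fun i j h => ?_⟩
    obtain ⟨h1, h2⟩ := mul_apply_eq_zero_of_strict hK hM i j (not_lt.2 h)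
    rw [add_mul, mul_add, Matrix.add_apply, Matrix.add_apply, h1, h2, hTφ]
    congr 2
    simp only [mul_assoc, Units.inv_mul_cancel_left]
    rw [← mul_assoc D, hD φ hφ, mul_assoc]
  rw [(Submodule.equivMapOfInjective T hT _).finrank_eq]
  exact Submodule.finrank_mono hle

-- The bound holds near `F` by conjugation. On the line `F + ε • F'` with small `ε ≠ 0`,
-- semicontinuity bounds the stabilizer dimension by that of `F'`, which may be far from `F`.
open Filter Topology in
theorem IsRigid.finrank_edgeInvariants_le (hF : IsRigid (fun i j => α i ≤ α j) F)
    (F' : Matrix ι ι ℂ) :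
    Module.finrank ℂ (edgeInvariants F) ≤
      Module.finrank ℂ (incidenceStabilizer (fun i j => α i ≤ α j) F') := by
  let _ : NormedRing (Matrix ι ι ℂ) := Matrix.linftyOpNormedRing
  let _ : NormedAlgebra ℂ (Matrix ι ι ℂ) := Matrix.linftyOpNormedAlgebra
  have _ : CompleteSpace (Matrix ι ι ℂ) := FiniteDimensional.complete ℂ _
  classical
  have hnear : ∀ᶠ F₁ in 𝓝 F, Module.finrank ℂ (edgeInvariants F) ≤
      Module.finrank ℂ (incidenceStabilizer (fun i j => α i ≤ α j) F₁) := by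
    filter_upwards [eventually_exists_conj F
      (LinearMap.toContinuousLinearMap (entryProj (fun i j => α i ≤ α j)))
      (LinearMap.toContinuousLinearMap
        (entryProj (fun i j => ∀ φ ∈ edgeInvariants F, φ i = φ j)))
      (LinearMap.toContinuousLinearMap (entryProj (fun i j => α i < α j)))
      hF.exists_infinitesimal_conj]
    rintro _ ⟨X, D, K, hU, rfl⟩
    refine finrank_edgeInvariants_le_of_conj hU ?_ ?_ ?_
    · refine blockTriangular_one.add fun i j h => ?_
      rw [LinearMap.coe_toContinuousLinearMap', entryProj_apply, if_neg (not_le.2 h)]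
    · intro φ hφ
      rw [add_mul, mul_add, mem_edgeInvariants_iff.1 hφ]
      congr 1
      ext i j
      rw [mul_diagonal, diagonal_mul, LinearMap.coe_toContinuousLinearMap', entryProj_apply]
      split_ifs with h
      · rw [h φ hφ, mul_comm]
      · simp
    · intro i j h
      rw [LinearMap.coe_toContinuousLinearMap', entryProj_apply, if_neg h]
  have hlim : Tendsto (fun ε : ℂ => F + ε • F') (𝓝[≠] 0) (𝓝 F) := by
    have : Continuous fun ε : ℂ => F + ε • F' := by fun_prop
    have h := this.tendsto 0
    rw [zero_smul, add_zero] at h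
    exact h.mono_left nhdsWithin_le_nhds
  obtain ⟨ε, h1, h2⟩ := ((hlim.eventually hnear).and
    (eventually_finrank_ker_add_smul_le (commutatorMap α F')
      (commutatorMap α F))).exists
  rw [ker_commutatorMap] at h2
  -- The support component of the combined map is scaled by `1 + ε`, so only the inclusion of the
  -- stabilizer in its kernel is claimed; that suffices.
  refine h1.trans (le_trans (Submodule.finrank_mono fun M hM => ?_) h2)
  rw [← ker_commutatorMap, LinearMap.mem_ker] at hM
  have hM1 : entryProj (fun i j => α j < α i) M = 0 := congrArg Prod.fst hM
  have hM2 : entryProj (fun i j => α j ≤ α i) ((F + ε • F') * M - M * (F + ε • F')) = 0 :=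
    congrArg Prod.snd hM
  rw [LinearMap.mem_ker]
  refine Prod.ext ?_ ?_
  · change entryProj (fun i j => α j < α i) M + ε • entryProj (fun i j => α j < α i) M = 0
    rw [hM1, smul_zero, add_zero]
  · change entryProj (fun i j => α j ≤ α i) (F * M - M * F) +
      ε • entryProj (fun i j => α j ≤ α i) (F' * M - M * F') = 0
    rw [← map_smul, ← map_add, ← hM2]
    congr 1
    simp only [add_mul, mul_add, smul_mul_assoc, mul_smul_comm, smul_sub]
    abel

theorem IsRigid.finrank_edgeInvariants_eq (hF : IsRigid (fun i j => α i ≤ α j) F) :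
    Module.finrank ℂ (incidenceStabilizer (fun i j => α i ≤ α j) F) =
      Module.finrank ℂ (edgeInvariants F) := by
  have h : incidenceStabilizer (fun i j => α i ≤ α j) F =
      (edgeInvariants F).map (diagonalLinearMap ι ℂ ℂ) := by
    ext M
    constructor
    · intro hM
      have hd : M = diagonal fun i => M i i := by
        ext i j
        by_cases h : i = j
        · subst h; simp
        · simp [h, hF.2 M hM i j h]
      refine ⟨fun i => M i i, mem_edgeInvariants_iff.2 ?_, hd.symm⟩
      rw [← hd]
      ext i j
      by_cases h : α j ≤ α i
      · exact hM.2 i j h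
      · rw [hd, mul_diagonal, diagonal_mul, hF.1 i j h, zero_mul, mul_zero]
    · rintro ⟨φ, hφ, rfl⟩
      refine ⟨fun i j h => blockTriangular_diagonal φ (not_le.1 h), fun i j _ => ?_⟩
      exact congrFun (congrFun (mem_edgeInvariants_iff.1 hφ) i) j
  rw [h]
  exact (Submodule.equivMapOfInjective _ diagonal_injective _).finrank_eq.symm

end Regular

/-! ### The index of a parabolic as an orbit count. -/

theorem lt_sum_take_iff (l : List ℕ) {k x : ℕ} (hx : x < l.sum) :
    x < (l.take k).sum ↔ blockIndex l x < k := by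
  induction l generalizing k x with
  | nil => simp at hx
  | cons a l ih =>
    cases k with
    | zero => simp
    | succ k =>
      rw [List.sum_cons] at hx
      rw [List.take_succ_cons, List.sum_cons]
      simp only [blockIndex]
      split_ifs with h
      · omega
      · rw [← tsub_lt_iff_left (not_lt.1 h), ih (by omega)]
        omega

theorem mem_parabolic_iff {l : List ℕ} {M : Matrix (Fin l.sum) (Fin l.sum) ℂ} :
    M ∈ parabolic l ↔ ∀ i j : Fin l.sum, ¬ blockIndex l i ≤ blockIndex l j → M i j = 0 := by
  constructor
  · intro h i j hij
    refine h (blockIndex l i) i j ?_ ?_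
    · rw [lt_sum_take_iff l j.2]; omega
    · rw [← not_lt, lt_sum_take_iff l i.2]; omega
  · intro h k i j hj hi
    rw [lt_sum_take_iff l j.2] at hj
    rw [← not_lt, lt_sum_take_iff l i.2] at hi
    exact h i j (by omega)

theorem finrank_coadjointStabilizer {l : List ℕ} {f : Module.Dual ℂ (parabolic l)}
    {F : Matrix (Fin l.sum) (Fin l.sum) ℂ} (hf : ∀ y : parabolic l, f y = trace (F * y.1)) :
    Module.finrank ℂ (coadjointStabilizer f) =
      Module.finrank ℂ (incidenceStabilizer
        (fun i j : Fin l.sum => blockIndex l i ≤ blockIndex l j) F) := by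
  have hbr : ∀ x y : parabolic l, f ⁅x, y⁆ = trace ((F * x.1 - x.1 * F) * y.1) := fun x y => by
    rw [hf, LieSubalgebra.coe_bracket, Ring.lie_def, Matrix.mul_sub, Matrix.sub_mul, trace_sub,
      trace_sub, ← Matrix.mul_assoc, ← Matrix.mul_assoc, trace_mul_comm (F * y.1),
      ← Matrix.mul_assoc]
  have hmap : (coadjointStabilizer f).toSubmodule.map (parabolic l).toSubmodule.subtype =
      incidenceStabilizer (fun i j : Fin l.sum => blockIndex l i ≤ blockIndex l j) F := by
    ext M
    constructor
    · rintro ⟨x, hx, rfl⟩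
      refine ⟨mem_parabolic_iff.1 x.2, fun i j hij => ?_⟩
      have hy : single j i (1 : ℂ) ∈ parabolic l := mem_parabolic_iff.2 fun i' j' h => by
        rw [single_apply, if_neg]
        rintro ⟨rfl, rfl⟩
        exact h hij
      have h := hx ⟨_, hy⟩
      rw [hbr, trace_mul_single] at h
      exact sub_eq_zero.1 (by simpa using h)
    · rintro ⟨h1, h2⟩
      refine ⟨⟨M, mem_parabolic_iff.2 h1⟩, fun y => ?_, rfl⟩
      rw [hbr, trace]
      refine Finset.sum_eq_zero fun i _ => ?_
      rw [diag_apply, mul_apply]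
      refine Finset.sum_eq_zero fun j _ => ?_
      by_cases hij : blockIndex l j ≤ blockIndex l i
      · rw [Matrix.sub_apply, h2 i j hij, sub_self, zero_mul]
      · rw [mem_parabolic_iff.1 y.2 j i hij, mul_zero]
  rw [← hmap]
  exact (Submodule.equivMapOfInjective _ Subtype.val_injective _).finrank_eq

theorem exists_trace_form {l : List ℕ} (f : Module.Dual ℂ (parabolic l)) :
    ∃ F : Matrix (Fin l.sum) (Fin l.sum) ℂ, ∀ y : parabolic l, f y = trace (F * y.1) := by
  obtain ⟨g, hg⟩ := LinearMap.exists_extend (p := (parabolic l).toSubmodule) f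
  refine ⟨of fun i j => g (single j i 1), fun y => ?_⟩
  rw [← show g y.1 = f y from LinearMap.congr_fun hg y, eq_trace_mul]

/-- The index of a parabolic subalgebra is the number of classes of positions that are identified
by the composite of the block reversal and the total reversal. -/
theorem parabolicIndex_eq_card {l : List ℕ} {κ : Type*} [Fintype κ] (c : ℕ → κ)
    (hc : ∀ k, ∃ x < l.sum, c x = k)
    (hinv : ∀ x < l.sum, c (l.sum - 1 - blockReverse l x) = c x)
    (hfac : ∀ φ : ℕ → ℂ, (∀ x < l.sum, φ (l.sum - 1 - blockReverse l x) = φ x) →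
      ∀ x < l.sum, ∀ y < l.sum, c x = c y → φ x = φ y) :
    parabolicIndex l = Fintype.card κ := by
  obtain ⟨F, hF, hφ⟩ := hasRigidForm l [l.sum] rfl (by simp)
  have hrev : ∀ φ : ℕ → ℂ, IsReverseInvariant l [l.sum] l.sum φ ↔
      ∀ x < l.sum, φ (l.sum - 1 - blockReverse l x) = φ x := fun φ => by
    refine forall₂_congr fun x hx => ?_
    rw [blockReverse_of_lt _ (blockReverse_lt hx)]
  have hF' : IsRigid (fun i j : Fin l.sum => blockIndex l i ≤ blockIndex l j) F :=
    hF.congr fun i j => by simp [seaweed, blockIndex]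
  have hcard : Module.finrank ℂ (edgeInvariants F) = Fintype.card κ := by
    let T : (κ → ℂ) →ₗ[ℂ] (Fin l.sum → ℂ) := LinearMap.funLeft ℂ ℂ fun i => c i
    have hT : Function.Injective T := LinearMap.funLeft_injective_of_surjective _ _ _ fun k => by
      obtain ⟨x, hx, rfl⟩ := hc k
      exact ⟨⟨x, hx⟩, rfl⟩
    have hrange : LinearMap.range T = edgeInvariants F := by
      ext φ
      constructor
      · rintro ⟨ψ, rfl⟩
        exact (hφ fun x => ψ (c x)).2 ((hrev _).2 fun x hx => congrArg ψ (hinv x hx))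
      · intro h
        let φ' : ℕ → ℂ := fun x => if hx : x < l.sum then φ ⟨x, hx⟩ else 0
        have hφ' : ∀ i : Fin l.sum, φ' i = φ i := fun i => dif_pos i.2
        have h1 := hfac φ' ((hrev _).1 ((hφ φ').1 fun i j hij => by
          rw [hφ', hφ']; exact h i j hij))
        choose s hs hcs using hc
        refine ⟨fun k => φ' (s k), funext fun i => ?_⟩
        rw [← hφ']
        exact h1 _ (hs _) _ i.2 (hcs _)
    rw [← hrange, LinearMap.finrank_range_of_inj hT, Module.finrank_fintype_fun_eq_card]
  rw [← hcard]
  refine le_antisymm (Nat.sInf_le ?_) (le_csInf (Set.range_nonempty _) ?_)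
  · refine ⟨(traceLinearMap _ ℂ ℂ ∘ₗ LinearMap.mulLeft ℂ F) ∘ₗ
      (parabolic l).toSubmodule.subtype, ?_⟩
    exact (finrank_coadjointStabilizer fun y => rfl).trans hF'.finrank_edgeInvariants_eq
  · rintro _ ⟨f, rfl⟩
    obtain ⟨F₁, hF₁⟩ := exists_trace_form f
    exact (hF'.finrank_edgeInvariants_le F₁).trans (finrank_coadjointStabilizer hF₁).ge

/-! ### Three blocks. -/

theorem eq_of_modEq_gcd {Φ : ℤ → ℂ} {u v : ℤ} (hu : Function.Periodic Φ u)
    (hv : Function.Periodic Φ v) {x y : ℤ} (h : (Int.gcd u v : ℤ) ∣ y - x) : Φ x = Φ y := by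
  obtain ⟨t, ht⟩ := h
  have h1 := ((hu.int_mul (Int.gcdA u v * t)).add_period (hv.int_mul (Int.gcdB u v * t))) x
  rw [← h1]
  congr 1
  have := Int.gcd_eq_gcd_ab u v
  push_cast
  linear_combination (-t) * this - ht

/-- The permutation exchanges three intervals. Routing the middle interval through `q` extra points
makes it the first return of the rotation by `q + r` on `p + 2q + r` points, whose orbits are the
classes modulo the gcd. -/
theorem parabolicIndex_three (p q r : ℕ) (hpq : 0 < p + q) :
    parabolicIndex [p, q, r] = Nat.gcd (p + q) (q + r) := by
  set g := Nat.gcd (p + q) (q + r) with hg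
  have hg0 : 0 < g := Nat.gcd_pos_of_pos_left _ hpq
  have hgu : g ∣ p + q := Nat.gcd_dvd_left _ _
  have hgv : g ∣ q + r := Nat.gcd_dvd_right _ _
  have hsum : [p, q, r].sum = p + q + r := by simp [add_assoc]
  have h1 : ∀ x < p, p + q + r - 1 - blockReverse [p, q, r] x = x + (q + r) := fun x hx => by
    rw [blockReverse_of_lt _ hx]; omega
  have h2 : ∀ x, p ≤ x → x < p + q →
      p + q + r - 1 - blockReverse [p, q, r] x + p = x + r := fun x hx hx' => by
    rw [blockReverse_of_le _ hx, blockReverse_of_lt _ (by omega)]; omega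
  have h3 : ∀ x, p + q ≤ x → x < p + q + r →
      p + q + r - 1 - blockReverse [p, q, r] x + (p + q) = x := fun x hx hx' => by
    rw [blockReverse_of_le _ (by omega), blockReverse_of_le _ (by omega),
      blockReverse_of_lt _ (by omega)]; omega
  rw [parabolicIndex_eq_card (κ := Fin g) fun x => ⟨x % g, Nat.mod_lt _ hg0⟩, Fintype.card_fin]
  · intro k
    have := Nat.le_of_dvd hpq hgu
    exact ⟨k, by rw [hsum]; omega, Fin.ext (Nat.mod_eq_of_lt k.2)⟩
  · intro x hx
    rw [hsum] at hx ⊢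
    refine Fin.ext ?_
    change _ ≡ _ [MOD g]
    by_cases hxp : x < p
    · rw [h1 x hxp]
      exact Nat.add_modEq_left_iff.2 hgv
    by_cases hxq : x < p + q
    · have := h2 x (not_lt.1 hxp) hxq
      refine Nat.ModEq.add_right_cancel' (p + q) ?_
      rw [← add_assoc, this, show x + r + q = x + (q + r) by ring]
      exact (Nat.add_modEq_left_iff.2 hgv).trans (Nat.add_modEq_left_iff.2 hgu).symm
    · have := h3 x (not_lt.1 hxq) hx
      refine Nat.ModEq.symm ?_
      nth_rw 1 [← this]
      exact Nat.add_modEq_left_iff.2 hgu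
  · intro φ hφ x hx y hy hxy
    rw [hsum] at hφ hx hy
    -- The `q` extra points copy the middle block: `x + (q + r)` receives the value at `x`.
    let ψ : ℕ → ℂ := fun x => if x < p + q + r then φ x else φ (x - (q + r))
    have hψ : ∀ x < p + q + r, ψ x = φ x := fun x hx => if_pos hx
    have hψ' : ∀ x, p + q + r ≤ x → ψ x = φ (x - (q + r)) := fun x hx => if_neg (not_lt.2 hx)
    have hψ1 : ∀ x < p + q, ψ (x + (q + r)) = ψ x := fun x hx => by
      by_cases hxp : x < p
      · rw [hψ _ (by omega), hψ _ (by omega), ← h1 x hxp, hφ x (by omega)]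
      · rw [hψ' _ (by omega), hψ _ (by omega), Nat.add_sub_cancel]
    have hψ2 : ∀ x, p + q ≤ x → x < p + q + (q + r) → ψ (x - (p + q)) = ψ x := fun x hx hx' => by
      rw [hψ _ (by omega)]
      by_cases hxn : x < p + q + r
      · rw [hψ _ hxn, ← hφ x hxn]
        congr 1
        have := h3 x hx hxn
        omega
      · rw [hψ' _ (by omega), ← hφ (x - (q + r)) (by omega)]
        congr 1
        have := h2 (x - (q + r)) (by omega) (by omega)
        omega
    obtain ⟨N, hNe⟩ : ∃ N : ℤ, N = (p + q : ℕ) + (q + r : ℕ) := ⟨_, rfl⟩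
    have hN : 0 < N := by omega
    let Φ : ℤ → ℂ := fun x => ψ (x % N).toNat
    have hΦN : Function.Periodic Φ N := fun x => by simp [Φ]
    have hΦv : Function.Periodic Φ (q + r : ℕ) := fun x => by
      have hy0 := Int.emod_nonneg x hN.ne'
      have hy1 := Int.emod_lt_of_pos x hN
      simp only [Φ]
      by_cases hy : x % N < (p + q : ℕ)
      · have h4 : (x + (q + r : ℕ)) % N = x % N + (q + r : ℕ) := by
          rw [← Int.emod_add_emod, Int.emod_eq_of_lt (by omega) (by omega)]
        rw [h4, ← hψ1 (x % N).toNat (by omega)]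
        congr 1
        omega
      · rw [← hψ2 (x % N).toNat (by omega) (by omega)]
        have h4 : (x + (q + r : ℕ)) % N = x % N - (p + q : ℕ) := by
          rw [← Int.emod_add_emod, ← Int.sub_emod_right,
            Int.emod_eq_of_lt (by omega) (by omega)]
          omega
        rw [h4]
        congr 1
        omega
    have hΦu : Function.Periodic Φ (p + q : ℕ) := fun x => by
      rw [← hΦv, add_assoc, ← hNe]
      exact hΦN x
    have hΦ : ∀ x < p + q + r, Φ x = φ x := fun x hx => by
      simp only [Φ]
      rw [Int.emod_eq_of_lt (by omega) (by omega), Int.toNat_natCast, hψ x hx]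
    rw [← hΦ x hx, ← hΦ y hy]
    refine eq_of_modEq_gcd hΦu hΦv ?_
    rw [Int.gcd_natCast_natCast, ← hg]
    exact (Nat.modEq_iff_dvd.1 (Fin.ext_iff.1 hxy : x ≡ y [MOD g]))

/-! ### Four blocks: the return map modulo `3a`. -/

/-- The map of the integers that induces, modulo `3 * a`, the first return map of the composite
of the block reversals of `(a, a, a, b)` and the total reversal. -/
def returnMap (a b x : ℤ) : ℤ := x + b + (2 + x / a) * a

/-- On the last block the permutation subtracts `3a`, so an invariant function there is determined
by residues modulo `3a`. On the first three blocks the permutation agrees with `returnMap` modulo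
`3a`. -/
theorem parabolicIndex_four_eq_card {a b : ℕ} (ha : 0 < a) {κ : Type*} [Fintype κ] (C : ℤ → κ)
    (hsurj : C.Surjective) (hper : Function.Periodic C (3 * a))
    (hinv : ∀ x, C (returnMap a b x) = C x)
    (hfac : ∀ Φ : ℤ → ℂ, Function.Periodic Φ (3 * a) → (∀ x, Φ (returnMap a b x) = Φ x) →
      ∀ x y, C x = C y → Φ x = Φ y) :
    parabolicIndex [a, a, a, b] = Fintype.card κ := by
  have hsum : [a, a, a, b].sum = 3 * a + b := by simp; ring
  have h1 : ∀ x < 3 * a, ∃ k : ℤ, ((3 * a + b - 1 - blockReverse [a, a, a, b] x : ℕ) : ℤ)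
      = returnMap a b x + k * (3 * a) := fun x hx => by
    have ha' : (a : ℤ) ≠ 0 := by omega
    by_cases hx1 : x < a
    · refine ⟨0, ?_⟩
      rw [blockReverse_of_lt _ hx1, returnMap, Int.ediv_eq_zero_of_lt (by omega) (by omega)]
      omega
    by_cases hx2 : x < 2 * a
    · refine ⟨-1, ?_⟩
      have : (x : ℤ) / a = 1 := by
        rw [Int.ediv_eq_iff_of_pos (by omega)]; omega
      rw [blockReverse_of_le _ (by omega), blockReverse_of_lt _ (by omega), returnMap, this]
      omega
    · refine ⟨-2, ?_⟩
      have : (x : ℤ) / a = 2 := by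
        rw [Int.ediv_eq_iff_of_pos (by omega)]; omega
      rw [blockReverse_of_le _ (by omega), blockReverse_of_le _ (by omega),
        blockReverse_of_lt _ (by omega), returnMap, this]
      omega
  have h2 : ∀ x, 3 * a ≤ x → x < 3 * a + b →
      3 * a + b - 1 - blockReverse [a, a, a, b] x + 3 * a = x := fun x hx hx' => by
    rw [blockReverse_of_le _ (by omega), blockReverse_of_le _ (by omega),
      blockReverse_of_le _ (by omega), blockReverse_of_lt _ (by omega)]
    omega
  refine parabolicIndex_eq_card (fun x : ℕ => C x) ?_ ?_ ?_
  · intro k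
    obtain ⟨x, rfl⟩ := hsurj k
    have hx0 := Int.emod_nonneg x (show (3 * a : ℤ) ≠ 0 by omega)
    have hx1 := Int.emod_lt_of_pos x (show (0 : ℤ) < 3 * a by omega)
    refine ⟨(x % (3 * a)).toNat, by rw [hsum]; omega, ?_⟩
    rw [Int.toNat_of_nonneg hx0, Int.emod_def, mul_comm]
    exact hper.sub_int_mul_eq _
  · intro x hx
    rw [hsum] at hx ⊢
    by_cases hxa : x < 3 * a
    · obtain ⟨k, hk⟩ := h1 x hxa
      rw [hk, ← hinv x]
      exact hper.int_mul k _
    · have := h2 x (not_lt.1 hxa) hx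
      change C _ = C _
      rw [← hper ((3 * a + b - 1 - blockReverse [a, a, a, b] x : ℕ) : ℤ)]
      congr 1
      omega
  · intro φ hφ x hx y hy hxy
    rw [hsum] at hφ hx hy
    let Φ : ℤ → ℂ := fun x => φ (x % (3 * a)).toNat
    have hΦper : Function.Periodic Φ (3 * a) := fun x => by simp [Φ]
    have hΦ : ∀ x < 3 * a + b, Φ x = φ x := fun x => by
      induction x using Nat.strong_induction_on with
      | _ x ih =>
      intro hx
      by_cases hxa : x < 3 * a
      · simp only [Φ]
        rw [Int.emod_eq_of_lt (by omega) (by omega), Int.toNat_natCast]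
      · have h3 := h2 x (not_lt.1 hxa) hx
        rw [← hφ x hx, ← ih _ (by omega) (by omega),
          ← hΦper ((3 * a + b - 1 - blockReverse [a, a, a, b] x : ℕ) : ℤ)]
        congr 1
        omega
    have hΦ0 : ∀ x : ℕ, x < 3 * a → Φ (returnMap a b x) = Φ x := fun x hx => by
      obtain ⟨k, hk⟩ := h1 x hx
      rw [hΦ x (by omega), ← hφ x (by omega), ← hΦ _ (by omega), hk]
      exact (hΦper.int_mul k _).symm
    have hΦT : ∀ x, Φ (returnMap a b x) = Φ x := fun x => by
      have hx0 := Int.emod_nonneg x (show (3 * a : ℤ) ≠ 0 by omega)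
      have hx1 := Int.emod_lt_of_pos x (show (0 : ℤ) < 3 * a by omega)
      have hx2 := Int.emod_add_mul_ediv x (3 * a)
      set y := (x % (3 * a)).toNat with hy
      set k := x / (3 * a)
      have hyz : (y : ℤ) = x % (3 * a) := Int.toNat_of_nonneg hx0
      have hxy : x = y + k * (3 * a) := by rw [hyz]; linear_combination -hx2
      have h4 : returnMap a b x = returnMap a b y + (2 * k) * (3 * a) := by
        rw [hxy, returnMap, returnMap, show (y : ℤ) + k * (3 * a) = y + (k * 3) * a by ring,
          Int.add_mul_ediv_right _ _ (by omega)]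
        ring
      rw [h4, hxy]
      have h5 := hΦper.int_mul (2 * k) (returnMap a b y)
      have h6 := hΦper.int_mul k y
      simp only [Int.cast_id] at h5 h6
      rw [h5, h6]
      exact hΦ0 y (by omega)
    rw [← hΦ x hx, ← hΦ y hy]
    exact hfac Φ hΦper hΦT x y hxy

section ReturnMap

variable {a b : ℤ}

theorem returnMap_add_mul (ha : a ≠ 0) (x e : ℤ) :
    returnMap a b (x + a * e) = returnMap a b x + a * (2 * e) := by
  rw [returnMap, returnMap, Int.add_mul_ediv_left _ _ ha]
  ring

theorem iterate_returnMap_add_mul (ha : a ≠ 0) (j : ℕ) (x e : ℤ) :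
    (returnMap a b)^[j] (x + a * e) = (returnMap a b)^[j] x + a * (2 ^ j * e) := by
  induction j with
  | zero => simp
  | succ j ih =>
    rw [Function.iterate_succ_apply', Function.iterate_succ_apply', ih, returnMap_add_mul ha]
    ring

theorem exists_iterate_returnMap_eq (x : ℤ) (j : ℕ) :
    ∃ e, (returnMap a b)^[j] x = x + j * b + a * e := by
  induction j with
  | zero => exact ⟨0, by simp⟩
  | succ j ih =>
    obtain ⟨e, he⟩ := ih
    rw [Function.iterate_succ_apply', returnMap, he]
    exact ⟨e + (2 + (x + j * b + a * e) / a), by push_cast; ring⟩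

/-- The points whose residues modulo `gcd a b` agree lie on the same orbit modulo `a`. -/
theorem exists_iterate_returnMap_eq_add (ha : 0 < a) {x y : ℤ} (h : (Int.gcd a b : ℤ) ∣ y - x) :
    ∃ (j : ℕ) (e : ℤ), (returnMap a b)^[j] x = y + a * e := by
  obtain ⟨t, ht⟩ := h
  have h0 := Int.emod_nonneg (Int.gcdB a b * t) ha.ne'
  obtain ⟨j, hj⟩ := Int.eq_ofNat_of_zero_le h0
  obtain ⟨e, he⟩ := exists_iterate_returnMap_eq (a := a) (b := b) x j
  refine ⟨j, e - Int.gcdA a b * t - (Int.gcdB a b * t / a) * b, ?_⟩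
  have h1 := Int.gcd_eq_gcd_ab a b
  have h2 := Int.emod_add_mul_ediv (Int.gcdB a b * t) a
  rw [he, ← hj]
  linear_combination b * h2 - t * h1 - ht

theorem gcd_dvd_returnMap_sub (x : ℤ) : (Int.gcd a b : ℤ) ∣ returnMap a b x - x := by
  rw [returnMap, add_sub_right_comm, add_sub_cancel_left]
  exact (Int.gcd_dvd_right _ _).add ((Int.gcd_dvd_left _ _).mul_left _)

theorem apply_iterate_returnMap {κ : Type*} {Φ : ℤ → κ} (h : ∀ x, Φ (returnMap a b x) = Φ x)
    (j : ℕ) (x : ℤ) : Φ ((returnMap a b)^[j] x) = Φ x := by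
  induction j with
  | zero => rfl
  | succ j ih => rw [Function.iterate_succ_apply', h, ih]

/-- The displacement of the `m`-th iterate of the return map, in units of `a`. -/
def displacement (a b : ℤ) (m : ℕ) (x : ℤ) : ℤ := ((returnMap a b)^[m] x - x) / a

variable {m : ℕ}

theorem add_mul_displacement (hm : a ∣ m * b) (x : ℤ) :
    (returnMap a b)^[m] x = x + a * displacement a b m x := by
  obtain ⟨e, he⟩ := exists_iterate_returnMap_eq (a := a) (b := b) x m
  have : a ∣ (returnMap a b)^[m] x - x := by
    rw [he, add_assoc, add_sub_cancel_left]
    exact hm.add (dvd_mul_right _ _)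
  rw [displacement, Int.mul_ediv_cancel' this]
  ring

/-- The return map commutes with its `m`-th iterate and doubles shifts by multiples of `a`. Since
`2` is a unit modulo `3`, vanishing of the displacement modulo `3` is an orbit invariant. -/
theorem displacement_returnMap (ha : a ≠ 0) (hm : a ∣ m * b) (x : ℤ) :
    displacement a b m (returnMap a b x) = 2 * displacement a b m x := by
  have h1 := add_mul_displacement hm (returnMap a b x)
  rw [← Function.iterate_succ_apply, Function.iterate_succ_apply', add_mul_displacement hm x,
    returnMap_add_mul ha] at h1
  exact (mul_left_cancel₀ ha (add_left_cancel h1)).symm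

theorem displacement_iterate_returnMap (ha : a ≠ 0) (hm : a ∣ m * b) (j : ℕ) (x : ℤ) :
    displacement a b m ((returnMap a b)^[j] x) = 2 ^ j * displacement a b m x := by
  induction j with
  | zero => simp
  | succ j ih =>
    rw [Function.iterate_succ_apply', displacement_returnMap ha hm, ih]
    ring

theorem displacement_add_mul (ha : a ≠ 0) (hm : a ∣ m * b) (x e : ℤ) :
    displacement a b m (x + a * e) = displacement a b m x + (2 ^ m - 1) * e := by
  have h1 := add_mul_displacement hm (x + a * e)
  rw [iterate_returnMap_add_mul ha, add_mul_displacement hm x] at h1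
  refine mul_left_cancel₀ ha ?_
  linear_combination -h1

theorem three_dvd_two_pow_mul_iff (j : ℕ) (z : ℤ) : 3 ∣ 2 ^ j * z ↔ 3 ∣ z :=
  ⟨fun h => (IsCoprime.pow_right (by norm_num : IsCoprime (3 : ℤ) 2)).dvd_of_dvd_mul_left h,
    fun h => h.mul_left _⟩

end ReturnMap

/-- Since `2^m ≡ -1` modulo `3`, the `m`-th iterate reflects each fibre, with one fixed point and
one 2-cycle. The fixed points are those of displacement divisible by `3`, so the residue modulo `d`
and this divisibility classify orbits. -/
theorem parabolicIndex_four_of_odd {a b d m : ℕ} (ha : 0 < a) (hd : d = Nat.gcd a b)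
    (hm : a = d * m) (hodd : Odd m) : parabolicIndex [a, a, a, b] = 2 * d := by
  have hd0 : 0 < d := by rw [hd]; exact Nat.gcd_pos_of_pos_left _ ha
  have ha0 : (a : ℤ) ≠ 0 := by omega
  have hdg : (d : ℤ) = (Int.gcd a b : ℤ) := by rw [Int.gcd_natCast_natCast, hd]
  have hda : (d : ℤ) ∣ a := by rw [hm]; exact ⟨m, by push_cast; ring⟩
  have hmb : (a : ℤ) ∣ m * b := by
    obtain ⟨m', hm'⟩ : d ∣ b := by rw [hd]; exact Nat.gcd_dvd_right _ _
    exact ⟨m', by rw [hm, hm']; push_cast; ring⟩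
  obtain ⟨w, hw⟩ : ∃ w : ℤ, 2 ^ m = 3 * w + 2 := by
    obtain ⟨k, rfl⟩ := hodd
    have : (3 : ℤ) ∣ 4 ^ k - 1 := by simpa using sub_dvd_pow_sub_pow (4 : ℤ) 1 k
    obtain ⟨w, hw⟩ := this
    exact ⟨2 * w, by rw [pow_succ, pow_mul]; norm_num; linear_combination 2 * hw⟩
  have hadd : ∀ x e, displacement a b m (x + a * e) = displacement a b m x + e + 3 * (w * e) :=
    fun x e => by rw [displacement_add_mul ha0 hmb, hw]; ring
  have hmod : ∀ x : ℤ, (x % d).toNat < d := fun x => by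
    have := Int.emod_lt_of_pos x (show (0 : ℤ) < d by omega)
    omega
  have hmodEq : ∀ x y : ℤ, (d : ℤ) ∣ y - x ↔ (x % d).toNat = (y % d).toNat := fun x y => by
    have h1 := Int.emod_nonneg x (show (d : ℤ) ≠ 0 by omega)
    have h2 := Int.emod_nonneg y (show (d : ℤ) ≠ 0 by omega)
    rw [← Int.modEq_iff_dvd, Int.ModEq]
    omega
  rw [parabolicIndex_four_eq_card ha (κ := Fin d × Bool) fun x =>
    (⟨(x % d).toNat, hmod x⟩, decide ((3 : ℤ) ∣ displacement a b m x))]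
  · simp [mul_comm]
  · rintro ⟨k, c⟩
    obtain ⟨e, he⟩ : ∃ e : ℤ, decide ((3 : ℤ) ∣ displacement a b m (k + a * e)) = c := by
      cases c
      · refine ⟨1 - displacement a b m k, ?_⟩
        rw [hadd, decide_eq_false_iff_not]
        omega
      · refine ⟨- displacement a b m k, ?_⟩
        rw [hadd, decide_eq_true_iff]
        omega
    refine ⟨k + a * e, Prod.ext (Fin.ext ?_) he⟩
    have h1 : (d : ℤ) ∣ (k + a * e) - k := by
      rw [add_sub_cancel_left]; exact hda.mul_right _
    refine ((hmodEq _ _).1 h1).symm.trans ?_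
    rw [Int.emod_eq_of_lt (by omega) (by omega), Int.toNat_natCast]
  · intro x
    refine Prod.ext (Fin.ext ?_) ?_
    · refine ((hmodEq _ _).1 ?_).symm
      rw [add_sub_cancel_left]; exact hda.mul_left _
    · rw [mul_comm, decide_eq_decide, hadd]
      omega
  · intro x
    refine Prod.ext (Fin.ext ?_) ?_
    · refine ((hmodEq _ _).1 ?_).symm
      rw [hdg]; exact gcd_dvd_returnMap_sub x
    · rw [decide_eq_decide, displacement_returnMap ha0 hmb]
      omega
  · intro Φ hper hΦ x y hxy
    obtain ⟨h1, h2⟩ := Prod.ext_iff.1 hxy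
    rw [Fin.ext_iff, ← hmodEq, hdg] at h1
    rw [decide_eq_decide] at h2
    obtain ⟨j, e, hj⟩ := exists_iterate_returnMap_eq_add (by omega : (0 : ℤ) < a) h1
    have h3 := displacement_iterate_returnMap ha0 hmb j x
    have hperk : ∀ z e : ℤ, 3 ∣ e → Φ (z + a * e) = Φ z := fun z e he => by
      obtain ⟨k, rfl⟩ := he
      rw [show (a : ℤ) * (3 * k) = k * (3 * a) by ring]
      exact hper.int_mul k z
    rw [← three_dvd_two_pow_mul_iff j, ← h3, hj, hadd] at h2
    rw [← apply_iterate_returnMap hΦ j x, hj]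
    by_cases he : (3 : ℤ) ∣ e
    · exact hperk y e he
    -- Here `y` and `y + a * e` are the two points of the 2-cycle: the displacement of `y` is `e`
    -- modulo `3`, so the `m`-th iterate takes `y + a * e` back to `y` modulo `3a`.
    · rw [← apply_iterate_returnMap hΦ m, add_mul_displacement hmb, hadd, add_assoc, ← mul_add]
      apply hperk
      generalize w * e = u at *
      have h4 : e % 3 = 1 ∨ e % 3 = 2 := by omega
      have h5 : displacement a b m y % 3 = e % 3 := by omega
      omega

/-! ### Alternating sums and the case of even `m`. -/

open Finset in
theorem sum_neg_one_pow_mul_self (k : ℕ) : ∑ j ∈ range (2 * k), (-1 : ℤ) ^ j * j = -k := by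
  induction k with
  | zero => simp
  | succ k ih =>
    rw [mul_add, mul_one, sum_range_succ, sum_range_succ, ih, pow_succ, pow_mul]
    push_cast
    norm_num
    ring

open Finset in
theorem sum_neg_one_pow (k : ℕ) : ∑ j ∈ range (2 * k), (-1 : ℤ) ^ j = 0 := by
  rw [neg_one_geom_sum, if_pos (even_two_mul k)]

-- With `m` even and `n` therefore odd, `j ↦ j n mod m` permutes the residues and preserves parity,
-- hence signs.
open Finset in
theorem sum_neg_one_pow_mul_mod {m n : ℕ} (hm : Even m) (h : m.Coprime n) :
    ∑ j ∈ range m, (-1 : ℤ) ^ j * (j * n % m : ℕ) = ∑ j ∈ range m, (-1 : ℤ) ^ j * j := by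
  have hmaps : Set.MapsTo (fun j => j * n % m) (range m : Set ℕ) (range m) := fun j hj => by
    have : j < m := by simpa using hj
    simpa using Nat.mod_lt _ (by omega)
  have hinj : Set.InjOn (fun j => j * n % m) (range m : Set ℕ) := fun i hi j hj hij => by
    have h1 : i ≡ j [MOD m] := Nat.ModEq.cancel_right_of_coprime h hij
    exact Nat.ModEq.eq_of_lt_of_lt h1 (by simpa using hi) (by simpa using hj)
  refine sum_nbij (fun j => j * n % m) hmaps hinj
    (surjOn_of_injOn_of_card_le _ hmaps hinj le_rfl) fun j _ => ?_
  have hn : Odd n := by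
    rw [← Nat.not_even_iff_odd]
    intro hn
    have := Nat.dvd_gcd hm.two_dvd hn.two_dvd
    rw [h.gcd_eq_one] at this
    omega
  have hpar : (-1 : ℤ) ^ j = (-1) ^ (j * n % m) := by
    rw [neg_one_pow_eq_pow_mod_two, neg_one_pow_eq_pow_mod_two (n := j * n % m),
      Nat.mod_mod_of_dvd _ hm.two_dvd, Nat.mul_mod, Nat.odd_iff.1 hn, mul_one, Nat.mod_mod]
  rw [hpar]

open Finset in
/-- The alternating sum of the quotients `⌊j n / m⌋`. -/
theorem two_mul_sum_neg_one_pow_mul_div {k n : ℕ} (hk : 0 < k) (h : (2 * k).Coprime n) :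
    2 * ∑ j ∈ range (2 * k), (-1 : ℤ) ^ j * (j * n / (2 * k) : ℕ) = 1 - n := by
  have h1 := sum_neg_one_pow_mul_mod (even_two_mul k) h
  have h2 : ∑ j ∈ range (2 * k), (-1 : ℤ) ^ j * (j * n % (2 * k) : ℕ) =
      n * ∑ j ∈ range (2 * k), (-1 : ℤ) ^ j * j -
        2 * k * ∑ j ∈ range (2 * k), (-1 : ℤ) ^ j * (j * n / (2 * k) : ℕ) := by
    rw [mul_sum, mul_sum, ← sum_sub_distrib]
    refine sum_congr rfl fun j _ => ?_
    have : ((j * n % (2 * k) : ℕ) : ℤ) + 2 * k * (j * n / (2 * k) : ℕ) = j * n := by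
      exact_mod_cast Nat.mod_add_div (j * n) (2 * k)
    linear_combination (-1 : ℤ) ^ j * this
  rw [h2, sum_neg_one_pow_mul_self] at h1
  refine mul_left_cancel₀ (show (k : ℤ) ≠ 0 by omega) ?_
  linear_combination -h1

-- Modulo `3` the doubling is a sign change, so the recursion `e ↦ 2e + 2 + ⌊j n / m⌋` for the
-- multiple of `a` unrolls into an alternating sum.
open Finset in
theorem exists_iterate_returnMap_zero {d m n : ℕ} (hd : 0 < d) (hm : 0 < m) (j : ℕ) :
    ∃ e : ℤ, (returnMap (d * m : ℕ) (d * n : ℕ))^[j] 0 = j * (d * n : ℕ) + (d * m : ℕ) * e ∧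
      3 ∣ (-1) ^ j * e + ∑ i ∈ range j, (-1 : ℤ) ^ i * (2 + (i * n / m : ℕ)) := by
  induction j with
  | zero => exact ⟨0, by simp, by simp⟩
  | succ j ih =>
    obtain ⟨e, he, hdvd⟩ := ih
    refine ⟨e + (2 + (j * n / m : ℕ) + e), ?_, ?_⟩
    · have hdm : ((d * m : ℕ) : ℤ) ≠ 0 := by positivity
      have hdiv : (j * (d * n : ℕ) + (d * m : ℕ) * e : ℤ) / (d * m : ℕ) = (j * n / m : ℕ) + e := by
        rw [Int.add_mul_ediv_left _ _ hdm]
        congr 1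
        rw [show (j * (d * n : ℕ) : ℤ) = (d * (j * n) : ℕ) by push_cast; ring,
          ← Int.natCast_ediv, Nat.mul_div_mul_left _ _ hd]
      rw [Function.iterate_succ_apply', he, returnMap, hdiv]
      push_cast
      ring
    · rw [sum_range_succ]
      obtain ⟨c, hc⟩ := hdvd
      refine ⟨c - (-1) ^ j * e, ?_⟩
      rw [pow_succ]
      linear_combination hc

/-- The displacement is `n + e` with `e ≡ -S` modulo `3`, where `S` is the alternating sum of floors
and `2S = 1 - n`. So twice the displacement is `3n - 1 ≡ -1`. -/
theorem not_three_dvd_displacement_zero {d k n : ℕ} (hd : 0 < d) (hk : 0 < k)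
    (h : (2 * k).Coprime n) :
    ¬ (3 : ℤ) ∣ displacement (d * (2 * k) : ℕ) (d * n : ℕ) (2 * k) 0 := by
  obtain ⟨e, he, hdvd⟩ := exists_iterate_returnMap_zero (n := n) hd
    (show 0 < 2 * k by omega) (2 * k)
  have hne : ((d * (2 * k) : ℕ) : ℤ) ≠ 0 := by positivity
  have hdis : displacement (d * (2 * k) : ℕ) (d * n : ℕ) (2 * k) 0 = n + e := by
    refine mul_left_cancel₀ hne ?_
    have := add_mul_displacement (a := (d * (2 * k) : ℕ)) (b := (d * n : ℕ)) (m := 2 * k)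
      ⟨n, by push_cast; ring⟩ 0
    rw [he, zero_add] at this
    rw [← this]
    push_cast
    ring
  have hsum := two_mul_sum_neg_one_pow_mul_div hk h
  simp only [mul_add, Finset.sum_add_distrib, ← Finset.sum_mul, sum_neg_one_pow, zero_mul,
    zero_add, pow_mul, neg_one_sq, one_pow, one_mul] at hdvd
  rw [hdis]
  omega

/-- Adding `0 ≤ r < d` to a multiple of `d` never changes the floor of division by `d * m`, so both
orbits move in parallel. -/
theorem iterate_returnMap_add_of_lt {d m n : ℕ} {r : ℤ} (h0 : 0 ≤ r)
    (hr : r < d) (j : ℕ) (z : ℤ) :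
    ∃ t : ℤ, (returnMap (d * m : ℕ) (d * n : ℕ))^[j] (d * z) = d * t ∧
      (returnMap (d * m : ℕ) (d * n : ℕ))^[j] (d * z + r) = d * t + r := by
  induction j with
  | zero => exact ⟨z, rfl, rfl⟩
  | succ j ih =>
    obtain ⟨t, h1, h2⟩ := ih
    have h3 : (d * t + r) / ((d * m : ℕ) : ℤ) = d * t / (d * m : ℕ) := by
      push_cast
      rw [← Int.ediv_ediv_of_nonneg (by omega), ← Int.ediv_ediv_of_nonneg (by omega),
        Int.mul_add_ediv_left _ _ (by omega), Int.ediv_eq_zero_of_lt h0 hr, add_zero,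
        Int.mul_ediv_cancel_left _ (by omega)]
    refine ⟨t + n + (2 + d * t / (d * m : ℕ)) * m, ?_, ?_⟩
    · rw [Function.iterate_succ_apply', h1, returnMap]
      push_cast
      ring
    · rw [Function.iterate_succ_apply', h2, returnMap, h3]
      push_cast
      ring

theorem displacement_add_of_lt {d m n : ℕ} {r : ℤ} (h0 : 0 ≤ r)
    (hr : r < d) (z : ℤ) :
    displacement (d * m : ℕ) (d * n : ℕ) m (d * z + r) =
      displacement (d * m : ℕ) (d * n : ℕ) m (d * z) := by
  obtain ⟨t, h1, h2⟩ := iterate_returnMap_add_of_lt (n := n) (m := m) h0 hr m z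
  rw [displacement, displacement, h1, h2, add_sub_add_right_eq_sub]

/-- Since `2^m ≡ 1` modulo `3`, the `m`-th iterate translates each fibre. The translation is nonzero
at `0`, hence at all multiples of `d` by moving along orbits, hence everywhere; so each fibre is one
orbit and invariants have period `a`, then `b`. -/
theorem parabolicIndex_four_of_even {a b d m : ℕ} (ha : 0 < a) (hd : d = Nat.gcd a b)
    (hm : a = d * m) (heven : Even m) : parabolicIndex [a, a, a, b] = d := by
  have hd0 : 0 < d := by rw [hd]; exact Nat.gcd_pos_of_pos_left _ ha
  obtain ⟨n, hn⟩ : d ∣ b := by rw [hd]; exact Nat.gcd_dvd_right _ _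
  obtain ⟨k, hk⟩ := heven.two_dvd
  have hm0 : 0 < m := by
    rcases Nat.eq_zero_or_pos m with h | h
    · rw [h] at hm; omega
    · exact h
  have hcop : m.Coprime n := by
    have h1 : d * Nat.gcd m n = d * 1 := by
      rw [← Nat.gcd_mul_left, ← hm, ← hn, mul_one, hd]
    exact Nat.eq_of_mul_eq_mul_left hd0 h1
  have ha0 : (a : ℤ) ≠ 0 := by omega
  have hdg : (d : ℤ) = (Int.gcd a b : ℤ) := by rw [Int.gcd_natCast_natCast, hd]
  have hda : (d : ℤ) ∣ a := by rw [hm]; exact ⟨m, by push_cast; ring⟩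
  have hmb : (a : ℤ) ∣ m * b := ⟨n, by rw [hm, hn]; push_cast; ring⟩
  have hmod : ∀ x : ℤ, (x % d).toNat < d := fun x => by
    have := Int.emod_lt_of_pos x (show (0 : ℤ) < d by omega)
    omega
  have hmodEq : ∀ x y : ℤ, (d : ℤ) ∣ y - x ↔ (x % d).toNat = (y % d).toNat := fun x y => by
    have h1 := Int.emod_nonneg x (show (d : ℤ) ≠ 0 by omega)
    have h2 := Int.emod_nonneg y (show (d : ℤ) ≠ 0 by omega)
    rw [← Int.modEq_iff_dvd, Int.ModEq]
    omega
  obtain ⟨w, hw⟩ : (3 : ℤ) ∣ 2 ^ m - 1 := by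
    rw [hk, pow_mul]
    simpa using sub_dvd_pow_sub_pow (4 : ℤ) 1 k
  have hadd : ∀ x e, displacement a b m (x + a * e) = displacement a b m x + 3 * (w * e) :=
    fun x e => by rw [displacement_add_mul ha0 hmb, hw]; ring
  have hdis0 : ¬ (3 : ℤ) ∣ displacement a b m 0 := by
    rw [hm, hn, hk]
    exact not_three_dvd_displacement_zero hd0 (by omega) (hk ▸ hcop)
  have hdis : ∀ x, ¬ (3 : ℤ) ∣ displacement a b m x := fun x => by
    have h1 : displacement a b m x = displacement a b m (d * (x / d)) := by
      conv_lhs => rw [← Int.mul_ediv_add_emod x d]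
      rw [hm, hn]
      exact displacement_add_of_lt (Int.emod_nonneg _ (by omega))
        (Int.emod_lt_of_pos _ (by omega)) _
    obtain ⟨j, e, hj⟩ := exists_iterate_returnMap_eq_add (b := b) (by omega : (0 : ℤ) < a)
      (x := 0) (y := d * (x / d)) (by rw [sub_zero, ← hdg]; exact dvd_mul_right _ _)
    have h2 := displacement_iterate_returnMap ha0 hmb j 0
    rw [hj, hadd, ← h1] at h2
    have h3 := (three_dvd_two_pow_mul_iff j (displacement a b m 0)).not.2 hdis0
    rw [← h2] at h3
    generalize w * e = u at h3
    omega
  rw [parabolicIndex_four_eq_card ha (κ := Fin d) fun x => ⟨(x % d).toNat, hmod x⟩]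
  · simp
  · intro k
    refine ⟨k, Fin.ext ?_⟩
    change ((k : ℤ) % d).toNat = k
    rw [Int.emod_eq_of_lt (by omega) (by omega), Int.toNat_natCast]
  · intro x
    refine Fin.ext ((hmodEq _ _).1 ?_).symm
    rw [add_sub_cancel_left]; exact hda.mul_left _
  · intro x
    refine Fin.ext ((hmodEq _ _).1 ?_).symm
    rw [hdg]; exact gcd_dvd_returnMap_sub x
  · intro Φ hper hΦ x y hxy
    rw [Fin.ext_iff, ← hmodEq, hdg] at hxy
    have hperk : ∀ z e : ℤ, 3 ∣ e → Φ (z + a * e) = Φ z := fun z e he => by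
      obtain ⟨k, rfl⟩ := he
      rw [show (a : ℤ) * (3 * k) = k * (3 * a) by ring]
      exact hper.int_mul k z
    have hstep : ∀ z, Φ (z + a * displacement a b m z) = Φ z := fun z => by
      rw [← add_mul_displacement hmb, apply_iterate_returnMap hΦ]
    have hΦa : Function.Periodic Φ a := fun z => by
      have h1 := hdis z
      -- If the translation is `1` modulo `3`, it takes `z` to `z + a`; if it is `2`, it takes `z +
      -- a` to `z + 3a`, which is `z` modulo `3a`.
      by_cases h2 : (3 : ℤ) ∣ displacement a b m z - 1
      · rw [← hstep z, ← hperk (z + a) _ h2]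
        congr 1; ring
      · have h4 : displacement a b m (z + a) = displacement a b m z + 3 * w := by
          simpa using hadd z 1
        have h3 : (3 : ℤ) ∣ 1 + displacement a b m (z + a) := by omega
        rw [← hstep (z + a), ← hperk z _ h3]
        congr 1; ring
    have hΦb : Function.Periodic Φ b := fun z => by
      rw [← hΦ z, returnMap]
      exact (hΦa.int_mul _ _).symm
    exact eq_of_modEq_gcd hΦa hΦb hxy

/-! ### Comparison with the gcd formula and parity cases. -/

theorem mainTheorem6 (a b : ℕ) (ha : 0 < a) (hb : 0 < b) :
    parabolicIndex [a, a, a, b] = parabolicIndex [Nat.gcd a b, a, a] ∧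
    parabolicIndex [Nat.gcd a b, a, a]
      = Nat.gcd (a + Nat.gcd a b) (a - Nat.gcd a b) ∧
    (Odd a → parabolicIndex [a, a, a, b] = 2 * Nat.gcd a b) ∧
    (Even a → Odd b → parabolicIndex [a, a, a, b] = Nat.gcd a b) ∧
    (parabolicIndex [a, a, a, b] = 1 ↔ Even a ∧ Nat.gcd a b = 1) := by
  obtain ⟨d, hd⟩ : ∃ d, d = Nat.gcd a b := ⟨_, rfl⟩
  have hd0 : 0 < d := by rw [hd]; exact Nat.gcd_pos_of_pos_left _ ha
  obtain ⟨m, hm⟩ : d ∣ a := by rw [hd]; exact Nat.gcd_dvd_left _ _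
  rw [← hd]
  have hle : d ≤ a := Nat.le_of_dvd ha ⟨m, hm⟩
  have h3 : parabolicIndex [d, a, a] = Nat.gcd (a + d) (a - d) := by
    rw [parabolicIndex_three _ _ _ (by omega), add_comm d a,
      show a + a = (a - d) + (a + d) by omega, Nat.gcd_add_self_right]
  have hgcd : Nat.gcd (a + d) (a - d) = d * Nat.gcd (m + 1) (m - 1) := by
    rw [← Nat.gcd_mul_left, mul_add, Nat.mul_sub, mul_one, ← hm]
  have hm1 : 0 < m := by
    rcases Nat.eq_zero_or_pos m with h | h
    · rw [h] at hm; omega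
    · exact h
  have hgcd2 : Nat.gcd (m + 1) (m - 1) = Nat.gcd 2 (m - 1) := by
    rw [show m + 1 = 2 + (m - 1) by omega, Nat.gcd_add_self_left]
  rcases Nat.even_or_odd m with hme | hmo
  · have h4 := parabolicIndex_four_of_even ha hd hm hme
    have ha2 : Even a := by rw [hm]; exact hme.mul_left _
    have hg : Nat.gcd 2 (m - 1) = 1 := by
      have : Odd (m - 1) := Nat.Even.sub_odd hm1 hme odd_one
      exact (Nat.coprime_two_left.2 this)
    rw [h4, h3, hgcd, hgcd2, hg, mul_one]
    refine ⟨rfl, rfl, fun h => absurd ha2 (Nat.not_even_iff_odd.2 h), fun _ _ => rfl, ?_⟩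
    simp [ha2]
  · have h4 := parabolicIndex_four_of_odd ha hd hm hmo
    have hg : Nat.gcd 2 (m - 1) = 2 :=
      Nat.gcd_eq_left (even_iff_two_dvd.1 (Nat.Odd.sub_odd hmo odd_one))
    rw [h4, h3, hgcd, hgcd2, hg, mul_comm d 2]
    -- With `m` odd, an even `a` makes `d` even. This rules out odd `b` and `d = 1`.
    have hde : Even a → Even d := fun h => by
      rw [hm, Nat.even_mul] at h
      exact h.resolve_right (Nat.not_even_iff_odd.2 hmo)
    refine ⟨rfl, rfl, fun _ => rfl, fun h1 h2 => ?_, ?_⟩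
    · have h5 : 2 ∣ b := (hde h1).two_dvd.trans (by rw [hd]; exact Nat.gcd_dvd_right _ _)
      exact absurd (even_iff_two_dvd.2 h5) (Nat.not_even_iff_odd.2 h2)
    · constructor
      · intro h; omega
      · rintro ⟨h1, h2⟩
        have := hde h1
        rw [h2] at this
        exact absurd this (by decide)
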